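/- Work with min-plus arithmetic in tropical projective space $\mathbb{TP}^{n-1}=\mathbb{R}^n/\mathbb{R}(1,\dots,1)$. For $a=(a_1,\dots,a_6)\in\mathbb{TP}^5$, the tropical conic with coefficients $a$ is the set of all $(x,y,z)\in\mathbb{TP}^2$ at which the minimum of the six linear functions $$a_1+2x,\quad a_2+x+y,\quad a_3+2y,\quad a_4+y+z,\quad a_5+2z,\quad a_6+x+z$$ is attained at least twice. Given four points $P_i=(x_i,y_i,z_i)\in\mathbb{TP}^2$, $1\le i\le 4$, their pencil of conics is the set of all $a\in\mathbb{TP}^5$ such that $P_1,\dots,P_4$ lie on the conic with coefficients $a$. The four points are called generic if no $4\times 4$ submatrix of the $4\times 6$ matrix with rows $(2x_i,\,x_i+y_i,\,2y_i,\,y_i+z_i,\,2z_i,\,x_i+z_i)$ is tropically singular, i.e. for each $4\times 4$ submatrix $(m_{ij})$ the minimum $\min_{\sigma\in S_4}\sum_i m_{i\sigma(i)}$ is attained by exactly one permutation. Let $\Gamma$ be a trivalent tree with six leaves labeled by $x^2,xy,y^2,yz,z^2,xz$ and four unlabeled internal vertices of degree three; trees are identified if there is an isomorphism between them preserving the leaf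 labels. A tropical line in $\mathbb{TP}^5$ of combinatorial type $\Gamma$ is the image of an embedding of $\Gamma$ in $\mathbb{TP}^5$ in which the edges between internal vertices are line segments (of positive length) with directions spanned by integer vectors, the edge at the $i$-th leaf is an unbounded half ray in the coordinate direction $e_i$, and at each vertex the primitive integer vectors (in $\mathbb{Z}^6/\mathbb{Z}(1,\dots,1)$) in the directions of all outgoing edges sum to zero. The tree $\Gamma$ is realizable if there is a generic configuration of four points in $\mathbb{TP}^2$ whose pencil of conics is a tropical line of combinatorial type $\Gamma$. Then there are exactly $105$ trivalent trees with six labeled leaves, and exactly $14$ of them are realizable. Exactly twelve of the realizable trees are caterpillar trees (each of the four internal vertices is adjacent to at least one leaf), and exactly two of them are snowflake trees (some internal vertex is not adjacent to any leaf). -/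

import Mathlib

noncomputable section

/-! ### Tropical projective space and tropical determinants -/

/-- Tropical projective space `ℝⁿ / ℝ(1,…,1)`; `TropProj 3` is the tropical projective plane
and `TropProj 6` is the space of tropical conics. -/
abbrev TropProj (n : ℕ) : Type :=
  (Fin n → ℝ) ⧸ Submodule.span ℝ {(1 : Fin n → ℝ)}

/-- The class of a vector of homogeneous coordinates. -/
def TropProj.mk {n : ℕ} : (Fin n → ℝ) →ₗ[ℝ] TropProj n :=
  (Submodule.span ℝ {(1 : Fin n → ℝ)}).mkQ

/-- The class of an integer vector. -/
def TropProj.ofInt {n : ℕ} (u : Fin n → ℤ) : TropProj n :=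
  TropProj.mk fun i => (u i : ℝ)

/-- The tropical (min-plus) determinant. -/
def tropDet {k : ℕ} (A : Matrix (Fin k) (Fin k) ℝ) : ℝ :=
  Finset.univ.inf' Finset.univ_nonempty
    fun σ : Equiv.Perm (Fin k) => ∑ i, A i (σ i)

/-- A square matrix is tropically singular if the minimum in its tropical determinant is
attained at least twice. -/
def TropSingular {k : ℕ} (A : Matrix (Fin k) (Fin k) ℝ) : Prop :=
  ∃ σ τ : Equiv.Perm (Fin k), σ ≠ τ ∧
    ∑ i, A i (σ i) = tropDet A ∧ ∑ i, A i (τ i) = tropDet A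

/-! ### Tropical conics and their pencils -/

/-- The exponent vectors of the six monomials `x², xy, y², yz, z², xz`, in this order. -/
def conicSupport : Fin 6 → Fin 3 → ℕ :=
  ![![2, 0, 0], ![1, 1, 0], ![0, 2, 0], ![0, 1, 1], ![0, 0, 2], ![1, 0, 1]]

/-- The value at `x` of the tropical monomial number `k` (with coefficient `0`). -/
def conicMonomial (k : Fin 6) (x : Fin 3 → ℝ) : ℝ :=
  ∑ m, (conicSupport k m : ℝ) * x m

/-- The tropical conic with coefficient vector `a`: the points of the tropical projective plane at
which the minimum of the six linear functions `a k + conicMonomial k x` is attained at least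
twice. -/
def tropConic (a : Fin 6 → ℝ) : Set (TropProj 3) :=
  TropProj.mk '' {x | ∃ i j : Fin 6, i ≠ j ∧
    a i + conicMonomial i x = a j + conicMonomial j x ∧
    ∀ k, a i + conicMonomial i x ≤ a k + conicMonomial k x}

/-- The pencil of conics through four points, as a subset of the space of conics. -/
def conicPencil (P : Fin 4 → TropProj 3) : Set (TropProj 6) :=
  TropProj.mk '' {a | ∀ s, P s ∈ tropConic a}

/-- The `4 × 6` matrix with rows `(2xᵢ, xᵢ+yᵢ, 2yᵢ, yᵢ+zᵢ, 2zᵢ, xᵢ+zᵢ)`. -/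
def conicMatrix (x : Fin 4 → Fin 3 → ℝ) : Matrix (Fin 4) (Fin 6) ℝ :=
  Matrix.of fun s k => conicMonomial k (x s)

/-- The genericity condition on four points given by homogeneous coordinates: no
`4 × 4` submatrix of `conicMatrix x` is tropically singular. -/
def IsGenericConfig (x : Fin 4 → Fin 3 → ℝ) : Prop :=
  ∀ I : Fin 4 ↪o Fin 6, ¬ TropSingular ((conicMatrix x).submatrix id I)

/-! ### Trivalent trees with six labeled leaves -/

/-- The vertices: six leaves, labeled by the six monomials of `conicSupport`, and four internal
vertices (whose names are forgotten in `TreeType` below). -/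
abbrev TreeVertex : Type := Fin 6 ⊕ Fin 4

/-- A trivalent tree with six labeled leaves, on the vertex set `TreeVertex`. -/
structure TrivalentTree where
  graph : SimpleGraph TreeVertex
  isTree : graph.IsTree
  leaf_degree : ∀ i : Fin 6, (graph.neighborSet (Sum.inl i)).ncard = 1
  internal_degree : ∀ k : Fin 4, (graph.neighborSet (Sum.inr k)).ncard = 3

/-- Two trees are identified if they are isomorphic by an isomorphism that fixes every leaf. -/
instance TrivalentTree.setoid : Setoid TrivalentTree where
  r Γ Γ' := ∃ π : Equiv.Perm (Fin 4), ∀ u w : TreeVertex,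
    Γ.graph.Adj u w ↔ Γ'.graph.Adj (Sum.map id π u) (Sum.map id π w)
  iseqv :=
    { refl := fun Γ => ⟨1, fun u w => by
        rcases u with u | u <;> rcases w with w | w <;> simp⟩
      symm := by
        rintro Γ Γ' ⟨π, h⟩
        refine ⟨π⁻¹, fun u w => ?_⟩
        rw [h]
        rcases u with u | u <;> rcases w with w | w <;> simp
      trans := by
        rintro Γ Γ' Γ'' ⟨π, h⟩ ⟨ρ, h'⟩
        refine ⟨ρ * π, fun u w => ?_⟩
        rw [h, h']
        rcases u with u | u <;> rcases w with w | w <;> simp }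

/-- The trivalent trees with six labeled leaves and unlabeled internal vertices. -/
abbrev TreeType : Type := Quotient TrivalentTree.setoid

/-- Each of the four internal vertices is adjacent to at least one leaf. -/
def TrivalentTree.IsCaterpillar (Γ : TrivalentTree) : Prop :=
  ∀ k : Fin 4, ∃ i : Fin 6, Γ.graph.Adj (Sum.inr k) (Sum.inl i)

/-- Some internal vertex is not adjacent to any leaf. -/
def TrivalentTree.IsSnowflake (Γ : TrivalentTree) : Prop :=
  ∃ k : Fin 4, ∀ i : Fin 6, ¬ Γ.graph.Adj (Sum.inr k) (Sum.inl i)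

/-! ### Tropical lines as embedded trees -/

/-- An integer vector is primitive as an element of the lattice `ℤⁿ / ℤ(1,…,1)`: it is not a
multiple `m • w` in this lattice except for `m = ±1` (in particular it is not zero there). -/
def IsPrimitiveMod {n : ℕ} (u : Fin n → ℤ) : Prop :=
  ∀ (m c : ℤ) (w : Fin n → ℤ), u = m • w + c • (1 : Fin n → ℤ) → m = 1 ∨ m = -1

/-- The edge from the internal vertex `k` to the vertex `w`, when the internal vertices are placed
at the points `pos`: a segment if `w` is internal, and the half ray
in the direction `e_i` if `w` is the leaf `i`. -/
def edgeCell (pos : Fin 4 → TropProj 6) (k : Fin 4) : TreeVertex → Set (TropProj 6)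
  | Sum.inl i => {p | ∃ t : ℝ, 0 ≤ t ∧ p = pos k + t • TropProj.ofInt (Pi.single i 1)}
  | Sum.inr l => segment ℝ (pos k) (pos l)

open Classical in
/-- A tropical line in `TropProj 6` of combinatorial type `Γ`: an embedding of the tree `Γ` such
that all edges have directions spanned by (primitive) integer vectors, the leaf `i` becomes an
unbounded half ray in direction `e_i`, and at every vertex the primitive integer vectors in the
directions of the outgoing edges sum to zero. -/
structure TropicalLine (Γ : TrivalentTree) where
  /-- the positions of the vertices -/
  pos : Fin 4 → TropProj 6
  /-- `dir k w` is the primitive direction at vertex `k` of the edge towards `w`; its value is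
  irrelevant if there is no such edge -/
  dir : Fin 4 → TreeVertex → Fin 6 → ℤ
  pos_injective : Function.Injective pos
  dir_primitive : ∀ k w, Γ.graph.Adj (Sum.inr k) w → IsPrimitiveMod (dir k w)
  dir_leaf : ∀ k i, Γ.graph.Adj (Sum.inr k) (Sum.inl i) → dir k (Sum.inl i) = Pi.single i 1
  dir_edge : ∀ k l, Γ.graph.Adj (Sum.inr k) (Sum.inr l) →
    ∃ t : ℝ, 0 < t ∧ pos l - pos k = t • TropProj.ofInt (dir k (Sum.inr l))
  balanced : ∀ k, ∑ w with Γ.graph.Adj (Sum.inr k) w, TropProj.ofInt (dir k w) = 0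
  /-- distinct edges meet at most in a common end point -/
  embedded : ∀ k w k' w', Γ.graph.Adj (Sum.inr k) w → Γ.graph.Adj (Sum.inr k') w' →
    s(Sum.inr k, w) ≠ s(Sum.inr k', w') →
    ∀ p ∈ edgeCell pos k w ∩ edgeCell pos k' w', ∃ j : Fin 4, p = pos j ∧
      Sum.inr j ∈ s(Sum.inr k, w) ∧ Sum.inr j ∈ s(Sum.inr k', w')

/-- The underlying point set of a tropical line: the union of its edges. -/
def TropicalLine.carrier {Γ : TrivalentTree} (L : TropicalLine Γ) : Set (TropProj 6) :=
  {p | ∃ k w, Γ.graph.Adj (Sum.inr k) w ∧ p ∈ edgeCell L.pos k w}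

/-! ### Realizability -/

/-- There is a generic configuration of four points whose pencil of conics is a tropical line
of combinatorial type `Γ`. -/
def TrivalentTree.IsRealizable (Γ : TrivalentTree) : Prop :=
  ∃ x : Fin 4 → Fin 3 → ℝ, IsGenericConfig x ∧
    ∃ L : TropicalLine Γ, L.carrier = conicPencil fun s => TropProj.mk (x s)

/-- The realizable types of trees. -/
def realizableTypes : Set TreeType :=
  {T | ∃ Γ : TrivalentTree, Quotient.mk _ Γ = T ∧ Γ.IsRealizable}

/-- The types of caterpillar trees. -/
def caterpillarTypes : Set TreeType :=
  {T | ∃ Γ : TrivalentTree, Quotient.mk _ Γ = T ∧ Γ.IsCaterpillar}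

/-- The types of snowflake trees. -/
def snowflakeTypes : Set TreeType :=
  {T | ∃ Γ : TrivalentTree, Quotient.mk _ Γ = T ∧ Γ.IsSnowflake}

end

/-!
The tree of a generic pencil of conics must be planar with respect to the cyclic order
`x², xy, y², yz, z², xz` of the monomials on the boundary of the Newton triangle, and all `14` trees
with this property (the duals of the triangulations of a hexagon) occur.

*Necessity.* By balancing, the direction of an edge between internal vertices is the indicator
vector of the leaves `A` on its far side, so it suffices to show that the split `A | Aᶜ` is
noncrossing. Consider the conic `a` at an interior point of the edge. Since `a` may be moved both
ways along the indicator vector of `A`, the set `S s` of minimizing monomials at each of the four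
points meets `A`, and likewise `Aᶜ`, in no or in at least two elements. Genericity makes the columns
attaining the row minima a forest (`GenericMinors.card_lt_card_biUnion`): otherwise Hall's theorem
and an exchange along a cycle give a second cheapest matching of some minor. Counting in the
forest, each `S s` lies on one side of the split, and the sets on a side connect all of it. If the
split had a crossing, there would be crossing chords inside some `S s ⊆ A` and some `S t ⊆ Aᶜ`.
Their segments share a point of the Newton triangle, and each lies in a cell of the regular
subdivision given by `a`, so `S s` would meet `Aᶜ` (`isTight_or_isTight_of_chordsCross`). This is `isNoncrossing_of_card_ne_one`.

*Sufficiency.* For each of the `14` trees, four integer points and integer positions of the internal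
vertices are given. The tropical line through these positions lies in the pencil, as is seen from
the minimizing monomials at the vertices. Conversely, on three leaves in different branches
at a vertex, a point of the pencil satisfies the equation of a tropical line centered at
this vertex; these equations are circuits of the pencil (`GenericMinors.exists_circuit`), again
obtained by exchanging along a cycle. Hence the point lies in the cone of one of the branches at
each vertex, and following these branches through the tree leads to an edge containing it
(`TreeCode.isRealizable`).

*Counting.* The four internal vertices form a path (caterpillar trees) or a star (snowflake trees),
so a tree is given by the attachment of its leaves to a path or a star. With a normal form for the
symmetries of the path and of the star, the types of trees become a finite set of codes
(`bijective_typeOfCode`), which is enumerated.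
-/

open Finset Function

/-! ### Tropically nonsingular minors and exchange along cycles -/

section Exchange

variable {R C : Type*} [Fintype R]

/-- If the orbit of `s₀` under `f` contains no fixed point, then `f` runs around a cycle of length
at least two; following `f` on its periodic points only is a nontrivial permutation. -/
theorem exists_perm_ne_one_of_forall_iterate_ne (f : R → R) (s₀ : R)
    (h : ∀ n, f (f^[n] s₀) ≠ f^[n] s₀) :
    ∃ ρ : Equiv.Perm R, ρ ≠ 1 ∧ ∀ s, ρ s = f s ∨ ρ s = s := by
  classical
  have hb := bijOn_periodicPts f
  let g : R → R := fun s => if s ∈ periodicPts f then f s else s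
  have hg : Injective g := by
    intro a b hab
    by_cases ha : a ∈ periodicPts f <;> by_cases hb' : b ∈ periodicPts f <;>
      simp only [g, ha, hb', if_true, if_false] at hab
    · exact hb.injOn ha hb' hab
    · exact absurd (hab ▸ hb.mapsTo ha) hb'
    · exact absurd (hab ▸ hb.mapsTo hb') ha
    · exact hab
  refine ⟨Equiv.ofBijective g (Finite.injective_iff_bijective.1 hg), fun h1 => ?_, fun s => ?_⟩
  · obtain ⟨m, n, hmn, he⟩ := Finite.exists_ne_map_eq_of_infinite fun n : ℕ => f^[n] s₀
    wlog hlt : m < n generalizing m n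
    · exact this n m hmn.symm he.symm (by omega)
    have hp : f^[m] s₀ ∈ periodicPts f := by
      refine mk_mem_periodicPts (n := n - m) (by omega) ?_
      change f^[n - m] (f^[m] s₀) = _
      rw [← iterate_add_apply, Nat.sub_add_cancel hlt.le]
      exact he.symm
    have := congrArg (fun e : Equiv.Perm R => e (f^[m] s₀)) h1
    simp only [Equiv.ofBijective_apply, Equiv.Perm.coe_one, id, g, hp, if_true] at this
    exact h m this
  · by_cases hs : s ∈ periodicPts f <;> simp [g, hs]

/-- No maximal minor of `N` is tropically singular: an assignment `σ` of columns to the rows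
which is cheapest among those using the same columns is strictly cheaper than all others. -/
def GenericMinors (N : R → C → ℝ) : Prop :=
  ∀ σ : R → C, Injective σ → (∀ π : Equiv.Perm R, ∑ s, N s (σ s) ≤ ∑ s, N s (σ (π s))) →
    ∀ π : Equiv.Perm R, ∑ s, N s (σ (π s)) ≤ ∑ s, N s (σ s) → π = 1

theorem GenericMinors.add_col {N : R → C → ℝ} (hN : GenericMinors N) (a : C → ℝ) :
    GenericMinors fun s c => N s c + a c := by
  have key (σ : R → C) (π : Equiv.Perm R) : ∑ s, a (σ (π s)) = ∑ s, a (σ s) :=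
    Equiv.sum_comp π fun s => a (σ s)
  intro σ hσ h π hπ
  simp only [sum_add_distrib, key] at h hπ
  exact hN σ hσ (fun ρ => by linarith [h ρ]) π (by linarith)

theorem GenericMinors.exists_isFixedPt {N : R → C → ℝ} (hN : GenericMinors N) {σ : R → C}
    (hσ : Injective σ) (hmin : ∀ π : Equiv.Perm R, ∑ s, N s (σ s) ≤ ∑ s, N s (σ (π s)))
    {f : R → R} (hf : ∀ s, N s (σ (f s)) ≤ N s (σ s)) (s₀ : R) :
    ∃ n, f (f^[n] s₀) = f^[n] s₀ := by
  by_contra! h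
  obtain ⟨ρ, hρ, hρf⟩ := exists_perm_ne_one_of_forall_iterate_ne f s₀ h
  refine hρ (hN σ hσ hmin ρ (sum_le_sum fun s _ => ?_))
  rcases hρf s with h | h <;> rw [h]
  exact hf s

theorem exists_cheapest [DecidableEq C] (N : R → C → ℝ) (J : Finset C) (hJ : #J = Fintype.card R) :
    ∃ σ : R → C, Injective σ ∧ univ.image σ = J ∧
      ∀ τ : R → C, Injective τ → univ.image τ = J → ∑ s, N s (σ s) ≤ ∑ s, N s (τ s) := by
  classical
  let X := {σ : R → J // Injective σ}
  have : Nonempty X := by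
    obtain ⟨e⟩ : Nonempty (R ≃ J) := ⟨Fintype.equivOfCardEq (by simp [hJ])⟩
    exact ⟨e, e.injective⟩
  have : Finite X := inferInstance
  obtain ⟨⟨σ, hσ⟩, hmin⟩ := Finite.exists_min fun σ : X => ∑ s, N s (σ.1 s)
  have himg (τ : R → C) (hτ : Injective τ) (h : ∀ s, τ s ∈ J) : univ.image τ = J := by
    refine eq_of_subset_of_card_le (by simpa [Finset.subset_iff] using h) ?_
    rw [card_image_of_injective _ hτ, hJ, card_univ]
  refine ⟨fun s => σ s, Subtype.val_injective.comp hσ,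
    himg _ (Subtype.val_injective.comp hσ) fun s => (σ s).2, fun τ hτ h => ?_⟩
  have hm : ∀ s, τ s ∈ J := fun s => h ▸ mem_image_of_mem τ (mem_univ s)
  exact hmin ⟨fun s => ⟨τ s, hm s⟩, fun a b hab => hτ (congrArg Subtype.val hab)⟩

theorem perm_le_of_cheapest [DecidableEq C] {N : R → C → ℝ} {J : Finset C} {σ : R → C}
    (hσ : Injective σ) (himg : univ.image σ = J)
    (h : ∀ τ : R → C, Injective τ → univ.image τ = J → ∑ s, N s (σ s) ≤ ∑ s, N s (τ s))
    (π : Equiv.Perm R) : ∑ s, N s (σ s) ≤ ∑ s, N s (σ (π s)) := by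
  refine h (fun s => σ (π s)) (hσ.comp π.injective) ?_
  rw [← himg]
  ext c
  simp only [mem_image, mem_univ, true_and]
  exact ⟨fun ⟨s, hs⟩ => ⟨π s, hs⟩, fun ⟨s, hs⟩ => ⟨π.symm s, by simpa using hs⟩⟩

/-- The column `c` attains the minimum of row `s`. -/
def IsTight (N : R → C → ℝ) (s : R) (c : C) : Prop := ∀ c', N s c ≤ N s c'

/-- Columns attaining the row minima form a forest: if each row `s` is given at least two columns
`e s` attaining its minimum, then any `r ≥ 1` rows are given more than `r` columns altogether. A
violation, enlarged as far as possible and extended to a square submatrix with Hall's theorem,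
would allow one to modify the cheapest assignment along a cycle. -/
theorem GenericMinors.card_lt_card_biUnion [DecidableEq C] [Fintype C] {N : R → C → ℝ}
    (hN : GenericMinors N)
    (hRC : Fintype.card R ≤ Fintype.card C) (e : R → Finset C)
    (he : ∀ s, ∀ c ∈ e s, IsTight N s c) (he2 : ∀ s, 1 < #(e s))
    (K : Finset R) (hK : K.Nonempty) : #K < #(K.biUnion e) := by
  classical
  by_contra! hlt
  -- a violating set of rows of maximal size
  obtain ⟨K, hKm, hmax⟩ := exists_max_image
    (univ.filter fun K : Finset R => K.Nonempty ∧ #(K.biUnion e) ≤ #K) card ⟨K, by simp [hK, hlt]⟩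
  simp only [mem_filter, mem_univ, true_and] at hKm hmax
  obtain ⟨hK, hKC⟩ := hKm
  set D := K.biUnion e with hD
  -- the remaining rows can be matched to columns outside `D`
  obtain ⟨g, hg, hgm⟩ := (all_card_le_biUnion_card_iff_exists_injective
    (fun s : {s // s ∉ K} => e s \ D)).1 (by
      intro S
      rcases S.eq_empty_or_nonempty with rfl | hS
      · simp
      by_contra! hS2
      have hdis : Disjoint K (S.map (Embedding.subtype _)) := by
        rw [disjoint_left]; intro a ha hb
        obtain ⟨b, -, rfl⟩ := mem_map.1 hb
        exact b.2 ha
      have hc : #(K ∪ S.map (Embedding.subtype _)) = #K + #S := by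
        rw [card_union_of_disjoint hdis, card_map]
      have := hmax (K ∪ S.map (Embedding.subtype _)) ⟨hK.mono subset_union_left, by
        have hsub : (K ∪ S.map (Embedding.subtype _)).biUnion e ⊆
            D ∪ S.biUnion (fun s => e s \ D) := by
          intro c hc
          obtain ⟨s, hs, hcs⟩ := mem_biUnion.1 hc
          by_cases hcD : c ∈ D
          · exact mem_union_left _ hcD
          rcases mem_union.1 hs with hs | hs
          · exact mem_union_left _ (mem_biUnion.2 ⟨s, hs, hcs⟩)
          · obtain ⟨b, hb, rfl⟩ := mem_map.1 hs
            exact mem_union_right _ (mem_biUnion.2 ⟨b, hb, mem_sdiff.2 ⟨hcs, hcD⟩⟩)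
        have := card_le_card hsub
        have := card_union_le D (S.biUnion (fun s => e s \ D))
        omega⟩
      have := hS.card_pos
      omega)
  have hgD (s) : g s ∉ D := (mem_sdiff.1 (hgm s)).2
  have hcard : #(D ∪ univ.image g) ≤ Fintype.card R := by
    have h1 := card_union_le D (univ.image g)
    have h2 : #(univ.image g) ≤ Fintype.card {s // s ∉ K} := card_image_le
    have h3 : Fintype.card {s // s ∉ K} = Fintype.card R - #K := by
      rw [Fintype.card_subtype_compl, Fintype.card_coe]
    have h4 := card_le_univ K
    omega
  obtain ⟨J, hJ, hJc⟩ := exists_superset_card_eq hcard hRC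
  obtain ⟨σ, hσ, himg, hmin⟩ := exists_cheapest N J hJc
  -- a minimizing column of each row: in `D` for the rows of `K`, and the matched one otherwise
  have hf : ∀ s, ∃ c ∈ J, IsTight N s c ∧ (s ∈ K → c ∈ D ∧ c ≠ σ s) ∧
      (∀ h : s ∉ K, c = g ⟨s, h⟩) := by
    intro s
    by_cases hs : s ∈ K
    · obtain ⟨c, hc, hne⟩ := exists_mem_ne (he2 s) (σ s)
      have hcD : c ∈ D := mem_biUnion.2 ⟨s, hs, hc⟩
      exact ⟨c, hJ (mem_union_left _ hcD), he s c hc, fun _ => ⟨hcD, hne⟩, fun h => absurd hs h⟩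
    · exact ⟨g ⟨s, hs⟩, hJ (mem_union_right _ (mem_image_of_mem _ (mem_univ _))),
        he s _ (mem_sdiff.1 (hgm _)).1, fun h => absurd h hs, fun _ => rfl⟩
  choose f hfJ hft hfK hfg using hf
  have hinv : ∀ s, ∃ r, σ r = f s := fun s => by
    have := hfJ s
    rw [← himg] at this
    simpa using this
  choose π hπ using hinv
  obtain ⟨s₀, hs₀⟩ := hK
  obtain ⟨n, hn⟩ := hN.exists_isFixedPt hσ (perm_le_of_cheapest hσ himg hmin) (f := π)
    (fun s => by rw [hπ]; exact hft s _) s₀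
  -- along the orbit of `s₀` the cheapest assignment differs from `f`
  have hinvt : ∀ n, ∀ h : π^[n] s₀ ∉ K, σ (π^[n] s₀) ≠ g ⟨_, h⟩ := by
    intro n
    induction n with
    | zero => exact fun h => absurd hs₀ h
    | succ n ih =>
      generalize hr : π^[n] s₀ = r at ih
      have hr' : π^[n + 1] s₀ = π r := by rw [iterate_succ_apply', hr]
      simp only [hr', hπ]
      intro h heq
      by_cases hrK : r ∈ K
      · exact hgD _ (heq ▸ (hfK r hrK).1)
      · rw [hfg r hrK] at heq
        have h1 : r = π r := congrArg Subtype.val (hg heq)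
        exact ih hrK (by rw [← hfg r hrK, ← hπ, ← h1])
  have hfix : σ (π^[n] s₀) = f (π^[n] s₀) := by rw [← hπ, hn]
  by_cases h : π^[n] s₀ ∈ K
  · exact (hfK _ h).2 hfix.symm
  · exact hinvt n h (hfix.trans (hfg _ h))

/-- The circuits of the tropical linear space cut out by the rows of a matrix: if `T` has one
column more than needed to complete `Tᶜ` to a square submatrix in two ways, then there are numbers
`p t` (the tropical minors on the columns `Tᶜ ∪ {t}`) such that for all solutions `a` the minimum
of `a t + p t` over `t ∈ T` is attained at least twice. -/
theorem GenericMinors.exists_circuit [DecidableEq C] [Fintype C] {M : R → C → ℝ}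
    (hM : GenericMinors M)
    (T : Finset C) (hT : #Tᶜ + 1 = Fintype.card R) :
    ∃ p : C → ℝ, ∀ a : C → ℝ,
      (∀ s, ∃ c c', c ≠ c' ∧ IsTight (fun s c => M s c + a c) s c ∧
        IsTight (fun s c => M s c + a c) s c') →
      ∀ i ∈ T, ∃ j ∈ T, j ≠ i ∧ a j + p j ≤ a i + p i := by
  classical
  have hex : ∀ t : C, ∃ σ : R → C, t ∈ T → Injective σ ∧ univ.image σ = insert t Tᶜ ∧
      ∀ τ : R → C, Injective τ → univ.image τ = insert t Tᶜ →
        ∑ s, M s (σ s) ≤ ∑ s, M s (τ s) := by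
    intro t
    by_cases ht : t ∈ T
    · obtain ⟨σ, h⟩ := exists_cheapest M (insert t Tᶜ) (by
        rw [card_insert_of_notMem (by simpa using ht), hT])
      exact ⟨σ, fun _ => h⟩
    · have : Nonempty R := Fintype.card_pos_iff.1 (by omega)
      exact ⟨fun _ => t, fun h => absurd h ht⟩
  choose κ hκ using hex
  refine ⟨fun t => ∑ s, M s (κ t s), fun a ha i hi => ?_⟩
  set N : R → C → ℝ := fun s c => M s c + a c with hNdef
  have hN : GenericMinors N := hM.add_col a
  obtain ⟨hσ, himg, hmin⟩ := hκ i hi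
  set σ := κ i with hσdef
  have hsum (t : C) (ht : t ∈ T) (τ : R → C) (hτ : Injective τ)
      (h : univ.image τ = insert t Tᶜ) :
      ∑ s, N s (τ s) = ∑ s, M s (τ s) + a t + ∑ c ∈ Tᶜ, a c := by
    have h1 : ∑ s, a (τ s) = ∑ c ∈ univ.image τ, a c := by
      rw [sum_image fun x _ y _ h => hτ h]
    rw [h, sum_insert (by simpa using ht)] at h1
    simp only [hNdef, sum_add_distrib, h1]
    ring
  have hminN (π : Equiv.Perm R) : ∑ s, N s (σ s) ≤ ∑ s, N s (σ (π s)) := by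
    have := perm_le_of_cheapest hσ himg hmin π
    simp only [hNdef, sum_add_distrib, Equiv.sum_comp π fun s => a (σ s)]
    linarith
  have hmem (s) : σ s ∈ insert i Tᶜ := himg ▸ mem_image_of_mem σ (mem_univ s)
  obtain ⟨r, hr⟩ : ∃ r, σ r = i := by
    have : i ∈ univ.image σ := himg ▸ mem_insert_self _ _
    simpa using this
  have hσT (s) (hs : s ≠ r) : σ s ∉ T := by
    have := hmem s
    simp only [mem_insert, mem_compl] at this
    exact this.resolve_left fun h => hs (hσ (h.trans hr.symm))
  -- replacing the column `i` by `j`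
  have swap (j : C) (hj : j ∈ T) (hji : j ≠ i) (ρ : Equiv.Perm R) (q : R) (hq : ρ q = r)
      (h1 : ∀ s ≠ q, N s (σ (ρ s)) ≤ N s (σ s)) (h2 : N q j ≤ N q (σ q)) :
      a j + ∑ s, M s (κ j s) ≤ a i + ∑ s, M s (σ s) := by
    let τ : R → C := fun s => if s = q then j else σ (ρ s)
    have hτT (s) (hs : s ≠ q) : σ (ρ s) ∉ T :=
      hσT _ fun h => hs (ρ.injective (h.trans hq.symm))
    have hτ : Injective τ := by
      intro s t hst
      by_cases hs : s = q <;> by_cases ht : t = q <;>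
        simp only [τ, hs, ht, if_true, if_false] at hst
      · rw [hs, ht]
      · exact absurd (hst ▸ hj) (hτT t ht)
      · exact absurd (hst ▸ hj) (hτT s hs)
      · exact ρ.injective (hσ hst)
    have himτ : univ.image τ = insert j Tᶜ := by
      refine eq_of_subset_of_card_le ?_ ?_
      · intro c hc
        obtain ⟨s, -, rfl⟩ := mem_image.1 hc
        by_cases hs : s = q
        · simp [τ, hs]
        · simp only [τ, hs, if_false, mem_insert, mem_compl]
          exact Or.inr (hτT s hs)
      · rw [card_image_of_injective _ hτ, card_insert_of_notMem (by simpa using hj), hT, card_univ]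
    have hle : ∑ s, N s (τ s) ≤ ∑ s, N s (σ s) := by
      refine sum_le_sum fun s _ => ?_
      by_cases hs : s = q
      · simpa [τ, hs] using h2
      · simpa [τ, hs] using h1 s hs
    rw [hsum j hj τ hτ himτ, hsum i hi σ hσ himg] at hle
    have := (hκ j hj).2.2 τ hτ himτ
    linarith
  have hf : ∀ s, ∃ c, c ≠ σ s ∧ N s c ≤ N s (σ s) := by
    intro s
    obtain ⟨c, c', hcc, hc, hc'⟩ := ha s
    by_cases h : c = σ s
    · exact ⟨c', fun h' => hcc (h.trans h'.symm), hc' _⟩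
    · exact ⟨c, h, hc _⟩
  choose f hfne hfle using hf
  by_cases hfr : f r ∈ T
  · exact ⟨f r, hfr, hr ▸ hfne r, swap (f r) hfr (hr ▸ hfne r) 1 r rfl (fun s _ => le_rfl) (hfle r)⟩
  -- moving row `s` to column `f s` displaces the row `π s`, where all columns of `T` count as `i`
  have hπ : ∀ s, ∃ t, t ≠ s ∧ (f s ∈ T → t = r) ∧ (f s ∉ T → σ t = f s) := by
    intro s
    by_cases hs : f s ∈ T
    · exact ⟨r, fun h => hfr (h ▸ hs), fun _ => rfl, fun h => absurd hs h⟩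
    · have : f s ∈ univ.image σ := by rw [himg]; simp [hs]
      obtain ⟨t, -, ht⟩ := mem_image.1 this
      exact ⟨t, fun h => hfne s (by rw [← ht, h]), fun h => absurd h hs, fun _ => ht⟩
  choose π hπne hπT hπσ using hπ
  obtain ⟨ρ, hρ1, hρ⟩ := exists_perm_ne_one_of_forall_iterate_ne π r fun n => hπne _
  have hρle (s) (hs : ρ s ≠ r ∨ f s = i ∨ ρ s = s) : N s (σ (ρ s)) ≤ N s (σ s) := by
    rcases hρ s with h | h
    · by_cases hsT : f s ∈ T
      · have hr' : ρ s = r := h.trans (hπT s hsT)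
        rcases hs with hs | hs | hs
        · exact absurd hr' hs
        · rw [hr', hr, ← hs]; exact hfle s
        · rw [hs]
      · rw [h, hπσ s hsT]; exact hfle s
    · rw [h]
  obtain ⟨q, hq⟩ := ρ.surjective r
  -- if no other column of `T` is used, a minor has two cheapest matchings
  by_cases hcase : f q = i ∨ ρ q = q
  · refine absurd (hN σ hσ hminN ρ (sum_le_sum fun s _ => hρle s ?_)) hρ1
    by_cases hs : ρ s = r
    · rw [ρ.injective (hs.trans hq.symm)]; exact Or.inr hcase
    · exact Or.inl hs
  push Not at hcase
  have hfq : f q ∈ T := by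
    by_contra h
    rcases hρ q with h' | h'
    · exact h (by rw [← hπσ q h, ← h', hq, hr]; exact hi)
    · exact hcase.2 h'
  exact ⟨f q, hfq, hcase.1, swap (f q) hfq hcase.1 ρ q hq
    (fun s hs => hρle s (Or.inl fun h => hs (ρ.injective (h.trans hq.symm)))) (hfle q)⟩

end Exchange

/-! ### Crossing chords in the Newton triangle -/

section Chords

/-- The chords `a a'` and `b b'` of the hexagon `0, 1, …, 5` cross. -/
def ChordsCross (a a' b b' : Fin 6) : Prop :=
  (min a a' < b ∧ b < max a a') ∧ (b' < min a a' ∨ max a a' < b')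

instance (a a' b b' : Fin 6) : Decidable (ChordsCross a a' b b') := by
  unfold ChordsCross; infer_instance

/-- The six exponent vectors lie on the boundary of a triangle, in their cyclic order. Hence
segments between them which cross in the cyclic order have a common point. -/
theorem exists_common_barycenter : ∀ a a' b b' : Fin 6, ChordsCross a a' b b' →
    ∃ w w' u u' : Fin 3, 0 < (u : ℕ) + u' ∧ (w + w' : ℕ) = u + u' ∧ ∀ m,
      w * conicSupport a m + w' * conicSupport a' m =
        u * conicSupport b m + u' * conicSupport b' m := by
  decide +kernel

/-- If the segments between two minimizing monomials at each of two points of a conic cross, then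
the second segment contributes a minimizing monomial at the first point: both segments lie in the
regular subdivision of the Newton polygon induced by the coefficients of the conic. -/
theorem isTight_or_isTight_of_chordsCross {x : Fin 4 → Fin 3 → ℝ} {a : Fin 6 → ℝ}
    {N : Fin 4 → Fin 6 → ℝ} (hN : ∀ s c, N s c = conicMatrix x s c + a c)
    {s t : Fin 4} {i i' j j' : Fin 6} (hc : ChordsCross i i' j j')
    (hi : IsTight N s i) (hi' : IsTight N s i') (hj : IsTight N t j) (hj' : IsTight N t j') :
    IsTight N s j ∨ IsTight N s j' := by
  obtain ⟨w, w', u, u', hpos, hdeg, hbar⟩ := exists_common_barycenter i i' j j' hc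
  have key (r : Fin 4) : (w : ℝ) * N r i + w' * N r i' - (w * a i + w' * a i') =
      u * N r j + u' * N r j' - (u * a j + u' * a j') := by
    have h0 := congrArg (Nat.cast : ℕ → ℝ) (hbar 0)
    have h1 := congrArg (Nat.cast : ℕ → ℝ) (hbar 1)
    have h2 := congrArg (Nat.cast : ℕ → ℝ) (hbar 2)
    push_cast at h0 h1 h2
    simp only [hN, conicMatrix, conicMonomial, Matrix.of_apply, Fin.sum_univ_three]
    linear_combination x r 0 * h0 + x r 1 * h1 + x r 2 * h2
  have hdeg' : (w : ℝ) + w' = u + u' := by exact_mod_cast hdeg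
  have hu : (0 : ℝ) ≤ u := by positivity
  have hu' : (0 : ℝ) ≤ u' := by positivity
  have hw : (0 : ℝ) ≤ w := by positivity
  have hw' : (0 : ℝ) ≤ w' := by positivity
  have e1 : N s i = N s i' := le_antisymm (hi _) (hi' _)
  have e2 : N t j = N t j' := le_antisymm (hj _) (hj' _)
  have k1 := key s
  have k2 := key t
  -- evaluation at the second point bounds the coefficients
  have b1 : (u + u' : ℝ) * N t j ≤ w * N t i + w' * N t i' := by
    rw [← hdeg', add_mul]
    exact add_le_add (mul_le_mul_of_nonneg_left (hj _) hw) (mul_le_mul_of_nonneg_left (hj _) hw')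
  have b2 : (u : ℝ) * (N s j - N s i) + u' * (N s j' - N s i) ≤ 0 := by
    rw [← e2] at k2
    rw [← e1] at k1
    have : (w + w' : ℝ) * N s i = (u + u') * N s i := by rw [hdeg']
    linarith
  have d1 : 0 ≤ N s j - N s i := sub_nonneg.2 (hi _)
  have d2 : 0 ≤ N s j' - N s i := sub_nonneg.2 (hi _)
  rcases Nat.eq_zero_or_pos (u : ℕ) with h0 | h0
  · right
    have h0' : (0 : ℝ) < u' := by exact_mod_cast (by omega : 0 < (u' : ℕ))
    have : N s j' - N s i ≤ 0 := by
      by_contra! h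
      linarith [mul_nonneg hu d1, mul_pos h0' h]
    intro c
    linarith [hi c]
  · left
    have h0' : (0 : ℝ) < u := by exact_mod_cast h0
    have : N s j - N s i ≤ 0 := by
      by_contra! h
      linarith [mul_nonneg hu' d2, mul_pos h0' h]
    intro c
    linarith [hi c]

/-- The split `A | Aᶜ` of the vertices of the hexagon `0, 1, …, 5` is noncrossing: no chord between
two elements of `A` crosses a chord between two elements of `Aᶜ`. -/
def IsNoncrossing (A : Finset (Fin 6)) : Prop :=
  ∀ i j k l : Fin 6, i < j → j < k → k < l →
    ¬ ((i ∈ A ↔ k ∈ A) ∧ (j ∈ A ↔ l ∈ A) ∧ ¬ (i ∈ A ↔ j ∈ A))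

instance : DecidablePred IsNoncrossing := fun A => by unfold IsNoncrossing; infer_instance

/-- Let `S s` be the sets of minimizing monomials of a conic at four generic points on it. If a
split `A | Aᶜ` of the monomials splits no single monomial off any of the sets `S s`, then it is
noncrossing. Indeed, by counting in the forest of `GenericMinors.card_lt_card_biUnion`,
each `S s` lies on one side of the split, and the sets on either side connect all of this side;
two crossing chords would lead to a set meeting both sides. -/
theorem isNoncrossing_of_card_ne_one {x : Fin 4 → Fin 3 → ℝ} {a : Fin 6 → ℝ}
    {N : Fin 4 → Fin 6 → ℝ} (hN : ∀ s c, N s c = conicMatrix x s c + a c)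
    (hx : GenericMinors (conicMatrix x)) {S : Fin 4 → Finset (Fin 6)}
    (hS : ∀ s c, c ∈ S s ↔ IsTight N s c) (A : Finset (Fin 6))
    (hA : ∀ s, #(S s ∩ A) ≠ 1) (hA' : ∀ s, #(S s ∩ Aᶜ) ≠ 1) : IsNoncrossing A := by
  have hNg : GenericMinors N := by
    have : N = fun s c => conicMatrix x s c + a c := by ext s c; exact hN s c
    rw [this]; exact hx.add_col a
  have hSne (s) : (S s).Nonempty := by
    obtain ⟨c, hc⟩ := Finite.exists_min (N s)
    exact ⟨c, (hS s c).2 hc⟩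
  intro i j k l hij hjk hkl hcr
  -- by symmetry, `i` and `k` lie in `A`
  wlog hiA : i ∈ A generalizing A
  · refine this Aᶜ hA' (by simpa using hA) ?_ (by simpa using hiA)
    simp only [mem_compl, not_iff_not]
    exact hcr
  obtain ⟨hik, hjl, hne⟩ := hcr
  have hkA : k ∈ A := hik.1 hiA
  have hjA : j ∉ A := fun h => hne ⟨fun _ => h, fun _ => hiA⟩
  have hlA : l ∉ A := fun h => hjA (hjl.2 h)
  -- the forest: the sets contained in `X` are fewer than the elements of `X`
  have count (e : Fin 4 → Finset (Fin 6)) (he : ∀ s, e s ⊆ S s) (he2 : ∀ s, 1 < #(e s))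
      (X : Finset (Fin 6)) (hX : X.Nonempty) : #{s | e s ⊆ X} + 1 ≤ #X := by
    rcases (univ.filter fun s => e s ⊆ X).eq_empty_or_nonempty with h | h
    · rw [h, card_empty]; exact hX.card_pos
    · refine (hNg.card_lt_card_biUnion (by simp) e (fun s c hc => (hS s c).1 (he s hc)) he2 _
        h).trans_le (card_le_card ?_)
      intro c hc
      obtain ⟨s, hs, hcs⟩ := mem_biUnion.1 hc
      exact (mem_filter.1 hs).2 hcs
  have hAne : A.Nonempty := ⟨i, hiA⟩
  have hAne' : Aᶜ.Nonempty := ⟨j, by simpa using hjA⟩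
  have hcardA : #A + #Aᶜ = 6 := by rw [card_add_card_compl]; rfl
  have hdisj (e : Finset (Fin 6)) (he : e.Nonempty) (h : e ⊆ A) : ¬ e ⊆ Aᶜ := by
    obtain ⟨c, hc⟩ := he
    exact fun h' => mem_compl.1 (h' hc) (h hc)
  -- as `#A + #Aᶜ = 6` and there are four points, equality holds for both sides of the split
  have total (e : Fin 4 → Finset (Fin 6)) (he : ∀ s, e s ⊆ S s) (he2 : ∀ s, 1 < #(e s))
      (hside : ∀ s, e s ⊆ A ∨ e s ⊆ Aᶜ) :
      #{s | e s ⊆ A} + 1 = #A ∧ #{s | e s ⊆ Aᶜ} + 1 = #Aᶜ := by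
    have h1 := count e he he2 A hAne
    have h2 := count e he he2 Aᶜ hAne'
    have h3 : (univ.filter fun s => e s ⊆ Aᶜ) = (univ.filter fun s => ¬ e s ⊆ A) := by
      refine filter_congr fun s _ => ⟨fun h h' => hdisj _ (card_pos.1 (by linarith [he2 s])) h' h,
        fun h => (hside s).resolve_left h⟩
    have h4 := card_filter_add_card_filter_not (s := (univ : Finset (Fin 4))) (fun s => e s ⊆ A)
    rw [← h3] at h4
    simp only [card_univ, Fintype.card_fin] at h4
    omega
  have big {X : Finset (Fin 6)} (h : X.Nonempty) (h1 : #X ≠ 1) : 1 < #X := by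
    have := h.card_pos
    omega
  have hcompl (s) (h : ¬ (S s ∩ A).Nonempty) : (S s ∩ Aᶜ).Nonempty := by
    obtain ⟨c, hc⟩ := hSne s
    refine ⟨c, mem_inter.2 ⟨hc, mem_compl.2 fun h' => h ⟨c, mem_inter.2 ⟨hc, h'⟩⟩⟩⟩
  -- a set meeting both sides could be counted on either of them
  have hside (s) : S s ⊆ A ∨ S s ⊆ Aᶜ := by
    let e : Fin 4 → Finset (Fin 6) := fun s => if (S s ∩ A).Nonempty then S s ∩ A else S s ∩ Aᶜ
    let e' : Fin 4 → Finset (Fin 6) := fun s => if (S s ∩ Aᶜ).Nonempty then S s ∩ Aᶜ else S s ∩ A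
    have t1 := (total e
      (fun s => by by_cases h : (S s ∩ A).Nonempty <;> simp [e, h, inter_subset_left])
      (fun s => by
        by_cases h : (S s ∩ A).Nonempty <;> simp only [e, h, if_true, if_false]
        · exact big h (hA s)
        · exact big (hcompl s h) (hA' s))
      (fun s => by by_cases h : (S s ∩ A).Nonempty <;> simp [e, h, inter_subset_right])).1
    have t2 := (total e'
      (fun s => by by_cases h : (S s ∩ Aᶜ).Nonempty <;> simp [e', h, inter_subset_left])
      (fun s => by
        by_cases h : (S s ∩ Aᶜ).Nonempty <;> simp only [e', h, if_true, if_false]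
        · exact big h (hA' s)
        · refine big ?_ (hA s)
          by_contra h'
          exact h (hcompl s h'))
      (fun s => by by_cases h : (S s ∩ Aᶜ).Nonempty <;> simp [e', h, inter_subset_right])).1
    have hsub : (univ.filter fun s => e' s ⊆ A) ⊆ univ.filter fun s => e s ⊆ A := by
      intro s hs
      simp only [mem_filter, mem_univ, true_and] at hs ⊢
      by_cases h : (S s ∩ Aᶜ).Nonempty
      · simp only [e', h, if_true] at hs
        exact absurd (inter_subset_right : S s ∩ Aᶜ ⊆ Aᶜ) (hdisj _ h hs)
      · have h' : (S s ∩ A).Nonempty := by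
          by_contra h'
          exact h (hcompl s h')
        simp [e, h', inter_subset_right]
    have heq := eq_of_subset_of_card_le hsub (by omega)
    by_cases h : (S s ∩ A).Nonempty
    · left
      have : s ∈ univ.filter fun s => e' s ⊆ A := by
        rw [heq]; simp [e, h, inter_subset_right]
      have hs := (mem_filter.1 this).2
      by_cases h2 : (S s ∩ Aᶜ).Nonempty
      · simp only [e', h2, if_true] at hs
        exact absurd (inter_subset_right : S s ∩ Aᶜ ⊆ Aᶜ) (hdisj _ h2 hs)
      · intro c hc
        by_contra h'
        exact h2 ⟨c, mem_inter.2 ⟨hc, mem_compl.2 h'⟩⟩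
    · right
      intro c hc
      exact mem_compl.2 fun h' => h ⟨c, mem_inter.2 ⟨hc, h'⟩⟩
  have hS2 (s) : 1 < #(S s) := by
    rcases hside s with h | h
    · have := hA s
      rw [inter_eq_left.2 h] at this
      exact big (hSne s) this
    · have := hA' s
      rw [inter_eq_left.2 h] at this
      exact big (hSne s) this
  have htot := total S (fun _ => Subset.rfl) hS2 hside
  -- the sets `S s` on a side `X` connect any two parts of `X`
  have connect (X : Finset (Fin 6)) (hX : #{s | S s ⊆ X} + 1 = #X) (q : Fin 6 → Prop)
      [DecidablePred q] (h1 : ∃ c ∈ X, q c) (h2 : ∃ c ∈ X, ¬ q c) :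
      ∃ s, S s ⊆ X ∧ ∃ c ∈ S s, ∃ c' ∈ S s, q c ∧ ¬ q c' := by
    by_contra! hno
    obtain ⟨c₁, h1X, h1q⟩ := h1
    obtain ⟨c₂, h2X, h2q⟩ := h2
    have k1 := count S (fun _ => Subset.rfl) hS2 (X.filter q) ⟨c₁, by simp [h1X, h1q]⟩
    have k2 := count S (fun _ => Subset.rfl) hS2 (X.filter fun c => ¬ q c)
      ⟨c₂, by simp [h2X, h2q]⟩
    have k3 := card_filter_add_card_filter_not (s := X) q
    have hsub : (univ.filter fun s => S s ⊆ X) ⊆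
        (univ.filter fun s => S s ⊆ X.filter q) ∪
          (univ.filter fun s => S s ⊆ X.filter fun c => ¬ q c) := by
      intro s hs
      have hs := (mem_filter.1 hs).2
      simp only [mem_union, mem_filter, mem_univ, true_and]
      by_cases h : ∃ c ∈ S s, q c
      · obtain ⟨c, hc, hqc⟩ := h
        exact Or.inl fun c' hc' => mem_filter.2 ⟨hs hc', hno s hs c hc c' hc' hqc⟩
      · exact Or.inr fun c' hc' => mem_filter.2 ⟨hs hc', fun h' => h ⟨c', hc', h'⟩⟩
    have k4 := (card_le_card hsub).trans (card_union_le _ _)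
    omega
  -- the chord `j l` separates `k` from `i`, so some chord `c c'` in `S s ⊆ A` crosses it
  obtain ⟨s, hsA, c, hc, c', hc', hq, hq'⟩ := connect A htot.1 (fun c => j < c ∧ c < l)
    ⟨k, hkA, hjk, hkl⟩ ⟨i, hiA, fun h => (h.1.trans hij).false⟩
  have hcj : c' ≠ j := fun h => hjA (h ▸ hsA hc')
  have hcl : c' ≠ l := fun h => hlA (h ▸ hsA hc')
  have hbetween : ∃ b ∈ Aᶜ, min c c' < b ∧ b < max c c' := by
    by_cases h : c' < j
    · exact ⟨j, by simpa using hjA, (min_le_right _ _).trans_lt h, lt_max_of_lt_left hq.1⟩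
    · refine ⟨l, by simpa using hlA, (min_le_left _ _).trans_lt hq.2, lt_max_of_lt_right ?_⟩
      by_contra h'
      exact hq' ⟨lt_of_le_of_ne (not_lt.1 h) hcj.symm, lt_of_le_of_ne (not_lt.1 h') hcl⟩
  have houtside : ∃ b ∈ Aᶜ, ¬ (min c c' < b ∧ b < max c c') := by
    by_cases h : c' < j
    · exact ⟨l, by simpa using hlA, fun h' => (max_lt hq.2 (h.trans (hjk.trans hkl))).not_gt h'.2⟩
    · refine ⟨j, by simpa using hjA, fun h' => (lt_min hq.1 ?_).not_gt h'.1⟩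
      exact lt_of_le_of_ne (not_lt.1 h) hcj.symm
  -- this chord separates `j` from `l`, so some chord `b b'` in `S t ⊆ Aᶜ` crosses it
  obtain ⟨t, htA, b, hb, b', hb', hr, hr'⟩ := connect Aᶜ htot.2 _ hbetween houtside
  have hbA' : b' ∉ A := mem_compl.1 (htA hb')
  have hbA : b ∉ A := mem_compl.1 (htA hb)
  have hcross : ChordsCross c c' b b' := by
    refine ⟨hr, ?_⟩
    by_contra! h
    refine hr' ⟨lt_of_le_of_ne h.1 ?_, lt_of_le_of_ne h.2 ?_⟩
    · intro h'
      rcases min_choice c c' with h'' | h'' <;> rw [h''] at h'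
      · exact hbA' (h' ▸ hsA hc)
      · exact hbA' (h' ▸ hsA hc')
    · intro h'
      rcases max_choice c c' with h'' | h'' <;> rw [h''] at h'
      · exact hbA' (h' ▸ hsA hc)
      · exact hbA' (h' ▸ hsA hc')
  rcases isTight_or_isTight_of_chordsCross hN hcross ((hS _ _).1 hc) ((hS _ _).1 hc')
    ((hS _ _).1 hb) ((hS _ _).1 hb') with h | h
  · exact hbA (hsA ((hS _ _).2 h))
  · exact hbA' (hsA ((hS _ _).2 h))

end Chords

/-! ### Points of the pencil -/

section Pencil

theorem TropProj.mk_eq_mk_iff {n : ℕ} {a b : Fin n → ℝ} :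
    TropProj.mk a = TropProj.mk b ↔ ∃ t : ℝ, ∀ i, a i = b i + t := by
  rw [TropProj.mk, Submodule.mkQ_apply, Submodule.mkQ_apply, Submodule.Quotient.eq,
    Submodule.mem_span_singleton]
  refine exists_congr fun t => ⟨fun h i => ?_, fun h => ?_⟩
  · have := congrFun h i
    simp only [Pi.smul_apply, Pi.one_apply, smul_eq_mul, mul_one, Pi.sub_apply] at this
    linarith
  · ext i
    simp only [Pi.smul_apply, Pi.one_apply, smul_eq_mul, mul_one, Pi.sub_apply, h i]
    ring

theorem conicMonomial_add_const (c : Fin 6) (x : Fin 3 → ℝ) (t : ℝ) :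
    conicMonomial c (fun m => x m + t) = conicMonomial c x + 2 * t := by
  have h : ∑ m, conicSupport c m = 2 := by revert c; decide
  have h' : ∑ m, (conicSupport c m : ℝ) = 2 := by exact_mod_cast h
  simp only [conicMonomial, mul_add, sum_add_distrib, ← sum_mul, h']

/-- The minimum in each row of the matrix of monomials, shifted by the coefficients `a`, is attained
at least twice: the four points lie on the conic with coefficients `a`. -/
def InPencil (x : Fin 4 → Fin 3 → ℝ) (a : Fin 6 → ℝ) : Prop :=
  ∀ s, ∃ c c', c ≠ c' ∧ IsTight (fun s c => conicMatrix x s c + a c) s c ∧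
    IsTight (fun s c => conicMatrix x s c + a c) s c'

theorem mk_mem_tropConic_iff {x : Fin 3 → ℝ} {a : Fin 6 → ℝ} :
    TropProj.mk x ∈ tropConic a ↔ ∃ i j : Fin 6, i ≠ j ∧
      a i + conicMonomial i x = a j + conicMonomial j x ∧
      ∀ k, a i + conicMonomial i x ≤ a k + conicMonomial k x := by
  refine ⟨?_, fun h => ⟨x, h, rfl⟩⟩
  rintro ⟨y, ⟨i, j, hij, he, hk⟩, hyx⟩
  obtain ⟨t, ht⟩ := TropProj.mk_eq_mk_iff.1 hyx
  have hy : y = fun m => x m + t := funext ht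
  subst hy
  simp only [conicMonomial_add_const] at he hk
  exact ⟨i, j, hij, by linarith, fun k => by linarith [hk k]⟩

theorem mk_mem_conicPencil_iff {x : Fin 4 → Fin 3 → ℝ} {a : Fin 6 → ℝ} :
    TropProj.mk a ∈ (conicPencil fun s => TropProj.mk (x s)) ↔ InPencil x a := by
  have key (b : Fin 6 → ℝ) : (∀ s, TropProj.mk (x s) ∈ tropConic b) ↔ InPencil x b := by
    refine forall_congr' fun s => mk_mem_tropConic_iff.trans ?_
    refine exists_congr fun i => exists_congr fun j => and_congr_right fun _ => ?_
    simp only [IsTight, conicMatrix, Matrix.of_apply]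
    refine ⟨fun ⟨h, h'⟩ => ⟨fun k => by linarith [h' k], fun k => by linarith [h' k]⟩,
      fun ⟨h, h'⟩ => ⟨by linarith [h j, h' i], fun k => by linarith [h k]⟩⟩
  rw [← key]
  refine ⟨?_, fun h => ⟨a, h, rfl⟩⟩
  rintro ⟨b, hb, hba⟩
  obtain ⟨t, ht⟩ := TropProj.mk_eq_mk_iff.1 hba
  intro s
  obtain ⟨i, j, hij, he, hk⟩ := mk_mem_tropConic_iff.1 (hb s)
  simp only [ht] at he hk
  exact mk_mem_tropConic_iff.2 ⟨i, j, hij, by linarith, fun k => by linarith [hk k]⟩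

theorem IsGenericConfig.genericMinors {x : Fin 4 → Fin 3 → ℝ} (hx : IsGenericConfig x) :
    GenericMinors (conicMatrix x) := by
  intro σ hσ hmin π hπ
  have hcard : #(univ.image σ) = 4 := by rw [card_image_of_injective _ hσ]; rfl
  let I := (univ.image σ).orderEmbOfFin hcard
  have hI : ∀ s, ∃ r, I r = σ s := by
    intro s
    have : σ s ∈ Set.range I := by simp [I]
    exact this
  choose g hg using hI
  have hginj : Injective g := fun s t h => hσ (by rw [← hg, ← hg, h])
  let π₀ : Equiv.Perm (Fin 4) := Equiv.ofBijective g (Finite.injective_iff_bijective.1 hginj)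
  have hsum (ρ : Equiv.Perm (Fin 4)) :
      ∑ s, (conicMatrix x).submatrix id I s ((π₀ * ρ) s) = ∑ s, conicMatrix x s (σ (ρ s)) := by
    refine sum_congr rfl fun s _ => ?_
    simp [π₀, hg]
  have hdet : tropDet ((conicMatrix x).submatrix id I) = ∑ s, conicMatrix x s (σ s) := by
    refine le_antisymm ((inf'_le _ (mem_univ (π₀ * 1))).trans (hsum 1).le) ?_
    refine le_inf' _ _ fun τ _ => ?_
    have := hsum (π₀⁻¹ * τ)
    rw [mul_inv_cancel_left] at this
    rw [this]
    exact hmin _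
  by_contra hne
  refine hx I ⟨π₀ * 1, π₀ * π, fun h => hne (mul_left_cancel h).symm, ?_, ?_⟩
  · rw [hsum, hdet]; rfl
  · rw [hsum, hdet]; exact le_antisymm hπ (hmin π)

/-- At an interior point of a segment of the pencil whose direction is the indicator vector of
`A`, no single monomial of `A` or of its complement is minimizing at one of the four points; hence
the split `A | Aᶜ` is noncrossing. -/
theorem isNoncrossing_of_segment {x : Fin 4 → Fin 3 → ℝ} (hx : IsGenericConfig x)
    {a : Fin 6 → ℝ} {A : Finset (Fin 6)} {t : ℝ} (ht : 0 < t)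
    (hseg : ∀ τ, 0 ≤ τ → τ ≤ t → InPencil x fun c => a c + if c ∈ A then τ else 0) :
    IsNoncrossing A := by
  classical
  let a' : Fin 6 → ℝ := fun c => a c + if c ∈ A then t / 2 else 0
  let N : Fin 4 → Fin 6 → ℝ := fun s c => conicMatrix x s c + a' c
  let S : Fin 4 → Finset (Fin 6) := fun s => univ.filter fun c => IsTight N s c
  have hS (s c) : c ∈ S s ↔ IsTight N s c := by simp [S]
  -- a bound for the gap between the row minima and the other entries
  obtain ⟨ε, hε, hεt, hgap⟩ : ∃ ε > 0, ε ≤ t / 2 ∧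
      ∀ s c c', IsTight N s c → ¬ IsTight N s c' → N s c + ε < N s c' := by
    have h1 : ∀ᶠ ε in nhdsWithin (0 : ℝ) (Set.Ioi 0), ∀ s c c', IsTight N s c →
        ¬ IsTight N s c' → N s c + ε < N s c' := by
      simp only [Filter.eventually_all]
      intro s c c' hc hc'
      have hlt : N s c < N s c' := by
        refine lt_of_le_of_ne (hc c') fun h => hc' fun k => h ▸ hc k
      filter_upwards [Ioo_mem_nhdsGT (sub_pos.2 hlt)] with ε hε
      linarith [hε.2]
    have h2 : ∀ᶠ ε in nhdsWithin (0 : ℝ) (Set.Ioi 0), ε ∈ Set.Ioo 0 (t / 2) :=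
      Ioo_mem_nhdsGT (by linarith)
    obtain ⟨ε, h, h'⟩ := (h1.and h2).exists
    exact ⟨ε, h'.1, h'.2.le, h⟩
  have nonunique (B : Finset (Fin 6)) (s) (b : Fin 6 → ℝ) (hb : InPencil x b)
      (r : ℝ) (hB : ∀ c, b c = a' c + (if c ∈ B then 0 else ε) + r) : #(S s ∩ B) ≠ 1 := by
    intro h1
    obtain ⟨c₀, h0⟩ := card_eq_one.1 h1
    obtain ⟨hc0, hc0B⟩ := mem_inter.1 (h0 ▸ mem_singleton_self c₀)
    have hc0 := (hS _ _).1 hc0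
    obtain ⟨c, c', hcc, hc, hc'⟩ := hb s
    have only (d) (hd : IsTight (fun s c => conicMatrix x s c + b c) s d) : d = c₀ := by
      have hle := hd c₀
      simp only [hB, hc0B, if_true] at hle
      by_contra hne
      by_cases hdB : d ∈ B
      · have : ¬ IsTight N s d := fun h' => hne (by
          have : d ∈ S s ∩ B := mem_inter.2 ⟨(hS _ _).2 h', hdB⟩
          rw [h0] at this
          exact mem_singleton.1 this)
        have := hgap s c₀ d hc0 this
        simp only [N, hdB, if_true] at this hle
        linarith
      · have := hc0 d
        simp only [N, hdB, if_false] at this hle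
        linarith
    exact hcc ((only c hc).trans (only c' hc').symm)
  refine isNoncrossing_of_card_ne_one (a := a') (N := N) (fun _ _ => rfl) hx.genericMinors hS A
    (fun s => ?_) (fun s => ?_)
  · refine nonunique A s _ (hseg (t / 2 - ε) (by linarith) (by linarith)) (-ε) fun c => ?_
    by_cases h : c ∈ A <;> simp [a', h]
    ring
  · refine nonunique Aᶜ s _ (hseg (t / 2 + ε) (by linarith) (by linarith)) 0 fun c => ?_
    by_cases h : c ∈ A <;> simp [a', h]
    ring

end Pencil

/-! ### Codes of trivalent trees -/

section Trees

/-- The two trees on four vertices: the star with center `3` if `star` is true, and the path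
`0, 1, 2, 3` otherwise. They are given by the first vertex `skelNext star k l` on the way from `k`
to `l` (with a meaningless value for `k = l`). -/
def skelNext (star : Bool) (k l : Fin 4) : Fin 4 :=
  if star then (if k = 3 then l else 3) else (if k < l then k + 1 else k - 1)

/-- Adjacency in the star or in the path. -/
def SkelAdj (star : Bool) (k l : Fin 4) : Prop := k ≠ l ∧ skelNext star k l = l

instance (star : Bool) (k l : Fin 4) : Decidable (SkelAdj star k l) := by
  unfold SkelAdj; infer_instance

theorem SkelAdj.symm : ∀ {star : Bool} {k l : Fin 4}, SkelAdj star k l → SkelAdj star l k := by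
  decide

/-- A code `(star, h)` of a tree with six leaves and four internal vertices: the internal vertices
form a star or a path, and the leaf `i` is attached to the internal vertex `h i`. -/
abbrev TreeCode : Type := Bool × (Fin 6 → Fin 4)

/-- The number of leaves attached to the internal vertex `k`, written out as a sum that is quick to
evaluate. -/
def leafCount (h : Fin 6 → Fin 4) (k : Fin 4) : ℕ :=
  (if h 0 = k then 1 else 0) + (if h 1 = k then 1 else 0) + (if h 2 = k then 1 else 0) +
    (if h 3 = k then 1 else 0) + (if h 4 = k then 1 else 0) + (if h 5 = k then 1 else 0)

theorem leafCount_eq (h : Fin 6 → Fin 4) (k : Fin 4) : leafCount h k = #{i | h i = k} := by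
  simp only [leafCount, card_filter, Fin.sum_univ_six]

/-- The first leaf attached to `k` comes before all leaves attached to `l`. -/
def Precedes (h : Fin 6 → Fin 4) (k l : Fin 4) : Prop := ∃ i, h i = k ∧ ∀ j, h j = l → i < j

instance (h : Fin 6 → Fin 4) (k l : Fin 4) : Decidable (Precedes h k l) := by
  unfold Precedes; infer_instance

/-- All internal vertices of the coded tree have degree three: the number of leaves makes up for the
degree in the path or star. -/
def TreeCode.IsTrivalent (c : TreeCode) : Prop :=
  if c.1 then leafCount c.2 3 = 0 ∧ leafCount c.2 0 = 2 ∧ leafCount c.2 1 = 2 ∧ leafCount c.2 2 = 2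
  else leafCount c.2 1 = 1 ∧ leafCount c.2 2 = 1 ∧ leafCount c.2 0 = 2 ∧ leafCount c.2 3 = 2

instance : DecidablePred TreeCode.IsTrivalent := fun c => by
  unfold TreeCode.IsTrivalent; infer_instance

theorem TreeCode.isTrivalent_iff (c : TreeCode) :
    c.IsTrivalent ↔ ∀ k, #{i | c.2 i = k} + #{l | SkelAdj c.1 k l} = 3 := by
  have hd : ∀ s k, #{l | SkelAdj s k l} = if s then ![1, 1, 1, 3] k else ![1, 2, 2, 1] k := by
    decide
  simp only [hd, ← leafCount_eq]
  obtain ⟨_ | _, h⟩ := c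
  · refine ⟨fun ⟨h1, h2, h0, h3⟩ k => ?_, fun H => ⟨?_, ?_, ?_, ?_⟩⟩
    · fin_cases k <;> simp [*]
    · simpa using H 1
    · simpa using H 2
    · simpa using H 0
    · simpa using H 3
  · refine ⟨fun ⟨h3, h0, h1, h2⟩ k => ?_, fun H => ⟨?_, ?_, ?_, ?_⟩⟩
    · fin_cases k <;> simp [*]
    · simpa using H 3
    · simpa using H 0
    · simpa using H 1
    · simpa using H 2

/-- A normal form of codes with respect to the symmetries of the path or of the star. -/
def TreeCode.IsCanonical (c : TreeCode) : Prop :=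
  if c.1 then Precedes c.2 0 1 ∧ Precedes c.2 1 2 else Precedes c.2 0 3

instance : DecidablePred TreeCode.IsCanonical := fun c => by
  unfold TreeCode.IsCanonical; infer_instance

theorem Precedes.asymm {h : Fin 6 → Fin 4} {k l : Fin 4} (h1 : Precedes h k l) :
    ¬ Precedes h l k := by
  obtain ⟨i, hi, h1⟩ := h1
  rintro ⟨j, hj, h2⟩
  exact (h1 j hj).asymm (h2 i hi)

theorem Precedes.trans {h : Fin 6 → Fin 4} {k l m : Fin 4} (h1 : Precedes h k l)
    (h2 : Precedes h l m) : Precedes h k m := by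
  obtain ⟨i, hi, h1⟩ := h1
  obtain ⟨j, hj, h2⟩ := h2
  exact ⟨i, hi, fun r hr => (h1 j hj).trans (h2 r hr)⟩

theorem precedes_or_precedes {h : Fin 6 → Fin 4} {k l : Fin 4} (hkl : k ≠ l)
    (hk : ∃ i, h i = k) (hl : ∃ i, h i = l) : Precedes h k l ∨ Precedes h l k := by
  have first (k) (hk : ∃ i, h i = k) : ∃ i, h i = k ∧ ∀ j, h j = k → i ≤ j := by
    obtain ⟨i, hi⟩ := hk
    have hne : (univ.filter fun i => h i = k).Nonempty := ⟨i, by simp [hi]⟩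
    refine ⟨_, (mem_filter.1 (min'_mem _ hne)).2, fun j hj => min'_le _ _ (by simp [hj])⟩
  obtain ⟨i, hi, hi'⟩ := first k hk
  obtain ⟨j, hj, hj'⟩ := first l hl
  rcases lt_or_ge i j with hij | hij
  · exact Or.inl ⟨i, hi, fun r hr => hij.trans_le (hj' r hr)⟩
  · refine Or.inr ⟨j, hj, fun r hr => (lt_of_le_of_ne hij fun he => ?_).trans_le (hi' r hr)⟩
    exact hkl (by rw [← hi, ← hj, he])

theorem precedes_comp_iff {h : Fin 6 → Fin 4} (π : Equiv.Perm (Fin 4)) {k l : Fin 4} :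
    Precedes (fun i => π (h i)) (π k) (π l) ↔ Precedes h k l := by
  simp [Precedes]

/-- The graph with a given code. -/
def treeGraph (c : TreeCode) : SimpleGraph TreeVertex where
  Adj
    | Sum.inl _, Sum.inl _ => False
    | Sum.inl i, Sum.inr k => c.2 i = k
    | Sum.inr k, Sum.inl i => c.2 i = k
    | Sum.inr k, Sum.inr l => SkelAdj c.1 k l
  symm := ⟨by
    rintro (i | k) (j | l) h
    · exact h
    · exact h
    · exact h
    · exact SkelAdj.symm h⟩
  loopless := ⟨by
    rintro (i | k) h
    · exact h
    · exact h.1 rfl⟩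

theorem ncard_neighborSet_eq (G : SimpleGraph TreeVertex) [DecidableRel G.Adj] (v : TreeVertex) :
    (G.neighborSet v).ncard = #{i | G.Adj v (Sum.inl i)} + #{k | G.Adj v (Sum.inr k)} := by
  have : G.neighborSet v = ((univ.filter fun w => G.Adj v w : Finset TreeVertex) : Set _) := by
    ext w; simp
  rw [this, Set.ncard_coe_finset, card_filter, card_filter, card_filter, Fintype.sum_sum_type]

instance (c : TreeCode) : DecidableRel (treeGraph c).Adj := fun u w => by
  rcases u with i | k <;> rcases w with j | l <;> simp only [treeGraph] <;> infer_instance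

theorem treeGraph_connected (c : TreeCode) : (treeGraph c).Connected := by
  rw [SimpleGraph.connected_iff_exists_forall_reachable]
  have hint : ∀ k, (treeGraph c).Reachable (Sum.inr 3) (Sum.inr k) := by
    have hadj (k l) (h : SkelAdj c.1 k l) : (treeGraph c).Reachable (Sum.inr k) (Sum.inr l) :=
      SimpleGraph.Adj.reachable (G := treeGraph c) h
    obtain ⟨_ | _, h⟩ := c
    · have h2 := hadj 3 2 (by decide : SkelAdj false 3 2)
      have h1 := h2.trans (hadj 2 1 (by decide : SkelAdj false 2 1))
      have h0 := h1.trans (hadj 1 0 (by decide : SkelAdj false 1 0))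
      intro k
      fin_cases k
      exacts [h0, h1, h2, SimpleGraph.Reachable.refl _]
    · intro k
      fin_cases k
      exacts [hadj 3 0 (by decide : SkelAdj true 3 0), hadj 3 1 (by decide : SkelAdj true 3 1),
        hadj 3 2 (by decide : SkelAdj true 3 2), SimpleGraph.Reachable.refl _]
  refine ⟨Sum.inr 3, ?_⟩
  rintro (i | k)
  · exact (hint (c.2 i)).trans
      (SimpleGraph.Adj.reachable (G := treeGraph c) (u := Sum.inr (c.2 i)) (v := Sum.inl i) rfl)
  · exact hint k

theorem ncard_treeGraph_neighborSet_inl (c : TreeCode) (i : Fin 6) :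
    ((treeGraph c).neighborSet (Sum.inl i)).ncard = 1 := by
  have : (treeGraph c).neighborSet (Sum.inl i) = {Sum.inr (c.2 i)} := by
    ext (j | k)
    · simp [treeGraph]
    · simp [treeGraph, eq_comm]
  rw [this, Set.ncard_singleton]

theorem ncard_treeGraph_neighborSet_inr {c : TreeCode} (hc : c.IsTrivalent) (k : Fin 4) :
    ((treeGraph c).neighborSet (Sum.inr k)).ncard = 3 := by
  rw [ncard_neighborSet_eq, ← c.isTrivalent_iff.1 hc k]
  congr!

/-- The tree with a given code. -/
def treeOf (c : TreeCode) (hc : c.IsTrivalent) : TrivalentTree where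
  graph := treeGraph c
  isTree := by
    rw [SimpleGraph.isTree_iff_connected_and_card]
    refine ⟨treeGraph_connected c, ?_⟩
    have hdeg (v) : (treeGraph c).degree v = ((treeGraph c).neighborSet v).ncard := by
      rw [← SimpleGraph.card_neighborSet_eq_degree, ← Nat.card_eq_fintype_card]; rfl
    have h := (treeGraph c).sum_degrees_eq_twice_card_edges
    simp only [hdeg, Fintype.sum_sum_type, ncard_treeGraph_neighborSet_inl,
      ncard_treeGraph_neighborSet_inr hc, sum_const, card_univ, Fintype.card_fin] at h
    rw [Nat.card_eq_fintype_card, Nat.card_eq_fintype_card, ← SimpleGraph.edgeFinset_card]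
    simp only [Fintype.card_sum, Fintype.card_fin]
    simp at h
    omega
  leaf_degree := ncard_treeGraph_neighborSet_inl c
  internal_degree := ncard_treeGraph_neighborSet_inr hc

end Trees

/-! ### Classification of trivalent trees -/

section Classification

/-- A symmetric irreflexive relation on four vertices with three edges and no isolated vertex is a
path or a star. -/
theorem exists_skeleton {G : Fin 4 → Fin 4 → Prop} [DecidableRel G] (hsymm : ∀ k l, G k l → G l k)
    (hirr : ∀ k, ¬ G k k) (hiso : ∀ k, ∃ l, G k l) (hcard : ∑ k, #{l | G k l} = 6) :
    ∃ (star : Bool) (π : Equiv.Perm (Fin 4)), ∀ k l, SkelAdj star k l ↔ G (π k) (π l) := by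
  have key : ∀ a b c d e f : Bool, ∀ g : Fin 4 → Fin 4 → Bool,
      g = ![![false, a, b, c], ![a, false, d, e], ![b, d, false, f], ![c, e, f, false]] →
      (∀ k, ∃ l, g k l = true) → (∑ k, #{l | g k l = true} = 6) →
      ∃ (star : Bool) (π : Equiv.Perm (Fin 4)), ∀ k l, SkelAdj star k l ↔ g (π k) (π l) = true := by
    simp only [forall_eq]
    decide +kernel
  have hs (k l) : decide (G k l) = decide (G l k) := decide_eq_decide.2 ⟨hsymm k l, hsymm l k⟩
  have hg : (fun k l => decide (G k l)) = ![![false, decide (G 0 1), decide (G 0 2),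
      decide (G 0 3)], ![decide (G 0 1), false, decide (G 1 2), decide (G 1 3)],
      ![decide (G 0 2), decide (G 1 2), false, decide (G 2 3)],
      ![decide (G 0 3), decide (G 1 3), decide (G 2 3), false]] := by
    have h0 (k) : decide (G k k) = false := decide_eq_false (hirr k)
    ext k l
    fin_cases k <;> fin_cases l <;> first | rfl | exact hs _ _ | exact h0 _
  have := key _ _ _ _ _ _ _ hg (by simpa using hiso) (by simpa using hcard)
  simpa using this

/-- The isomorphisms between paths and stars. -/
theorem skelAdj_iso : ∀ (s s' : Bool) (π : Equiv.Perm (Fin 4)),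
    (∀ k l, SkelAdj s k l ↔ SkelAdj s' (π k) (π l)) →
      s = s' ∧ if s then π 3 = 3 else (π = 1 ∨ (π 0 = 3 ∧ π 3 = 0)) := by
  decide +kernel

theorem skelAdj_true_iff : ∀ {π : Equiv.Perm (Fin 4)}, π 3 = 3 → ∀ k l,
    SkelAdj true k l ↔ SkelAdj true (π k) (π l) := by
  decide +kernel

/-- The attachment of the leaves can be brought into normal form by a symmetry of the path or of
the star. -/
theorem exists_isCanonical (star : Bool) (h : Fin 6 → Fin 4) (hc : TreeCode.IsTrivalent (star, h)) :
    ∃ π : Equiv.Perm (Fin 4), (∀ k l, SkelAdj star k l ↔ SkelAdj star (π k) (π l)) ∧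
      TreeCode.IsCanonical (star, fun i => π (h i)) := by
  have hne (k) (hk : 0 < leafCount h k) : ∃ i, h i = k := by
    rw [leafCount_eq, card_pos] at hk
    obtain ⟨i, hi⟩ := hk
    exact ⟨i, by simpa using hi⟩
  have move (π : Equiv.Perm (Fin 4)) (k l k' l' : Fin 4) (hk : π k = k') (hl : π l = l')
      (hp : Precedes h k l) : Precedes (fun i => π (h i)) k' l' := by
    rw [← hk, ← hl]
    exact (precedes_comp_iff π).2 hp
  cases star
  · obtain ⟨-, -, h0, h3⟩ : leafCount h 1 = 1 ∧ leafCount h 2 = 1 ∧ leafCount h 0 = 2 ∧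
      leafCount h 3 = 2 := hc
    rcases precedes_or_precedes (by decide : (0 : Fin 4) ≠ 3) (hne 0 (by omega))
      (hne 3 (by omega)) with hp | hp
    · exact ⟨1, fun k l => Iff.rfl, hp⟩
    · refine ⟨Fin.revPerm, by decide, ?_⟩
      exact move _ 3 0 0 3 (by decide) (by decide) hp
  · obtain ⟨-, h0, h1, h2⟩ : leafCount h 3 = 0 ∧ leafCount h 0 = 2 ∧ leafCount h 1 = 2 ∧
      leafCount h 2 = 2 := hc
    have fin (π : Equiv.Perm (Fin 4)) (a b c : Fin 4) (hπ : π 3 = 3) (ha : π a = 0) (hb : π b = 1)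
        (hc : π c = 2) (hab : Precedes h a b) (hbc : Precedes h b c) :
        ∃ π : Equiv.Perm (Fin 4), (∀ k l, SkelAdj true k l ↔ SkelAdj true (π k) (π l)) ∧
          TreeCode.IsCanonical (true, fun i => π (h i)) :=
      ⟨π, skelAdj_true_iff hπ, move π _ _ _ _ ha hb hab, move π _ _ _ _ hb hc hbc⟩
    have c01 := precedes_or_precedes (by decide : (0 : Fin 4) ≠ 1) (hne 0 (by omega))
      (hne 1 (by omega))
    have c12 := precedes_or_precedes (by decide : (1 : Fin 4) ≠ 2) (hne 1 (by omega))
      (hne 2 (by omega))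
    have c02 := precedes_or_precedes (by decide : (0 : Fin 4) ≠ 2) (hne 0 (by omega))
      (hne 2 (by omega))
    rcases c01 with c01 | c01 <;> rcases c12 with c12 | c12
    · exact fin 1 0 1 2 rfl rfl rfl rfl c01 c12
    · rcases c02 with c02 | c02
      · exact fin (Equiv.swap 1 2) 0 2 1 (by decide) (by decide) (by decide) (by decide) c02 c12
      · exact fin (Equiv.swap 0 2 * Equiv.swap 0 1) 2 0 1 (by decide) (by decide) (by decide)
          (by decide) c02 c01
    · rcases c02 with c02 | c02
      · exact fin (Equiv.swap 0 1) 1 0 2 (by decide) (by decide) (by decide) (by decide) c01 c02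
      · exact fin (Equiv.swap 0 1 * Equiv.swap 0 2) 1 2 0 (by decide) (by decide) (by decide)
          (by decide) c12 c02
    · exact fin (Equiv.swap 0 2) 2 1 0 (by decide) (by decide) (by decide) (by decide) c12 c01

/-- The renaming `π` of the internal vertices is an isomorphism from the tree with code `c`
to `Γ`. -/
def TrivalentTree.HasCode (Γ : TrivalentTree) (c : TreeCode) (π : Equiv.Perm (Fin 4)) : Prop :=
  ∀ u w, (treeGraph c).Adj u w ↔ Γ.graph.Adj (Sum.map id π u) (Sum.map id π w)

/-- In a connected graph a set of vertices closed under adjacency is empty or everything. -/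
theorem SimpleGraph.Connected.mem_of_closed {V : Type*} {G : SimpleGraph V} (hG : G.Connected)
    {S : Set V} (hS : ∀ u ∈ S, ∀ w, G.Adj u w → w ∈ S) {u : V} (hu : u ∈ S) (w : V) : w ∈ S := by
  obtain ⟨p⟩ := hG.preconnected u w
  induction p with
  | nil => exact hu
  | cons h _ ih => exact ih (hS _ hu _ h)

theorem TrivalentTree.exists_hasCode (Γ : TrivalentTree) :
    ∃ c π, TreeCode.IsTrivalent c ∧ TreeCode.IsCanonical c ∧ Γ.HasCode c π := by
  classical
  have hconn := Γ.isTree.connected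
  have hnbr (i : Fin 6) : ∃ w, Γ.graph.neighborSet (Sum.inl i) = {w} :=
    Set.ncard_eq_one.1 (Γ.leaf_degree i)
  -- two adjacent leaves would form a connected component
  have hll (i j : Fin 6) : ¬ Γ.graph.Adj (Sum.inl i) (Sum.inl j) := by
    intro hadj
    have hS : ∀ u ∈ ({Sum.inl i, Sum.inl j} : Set TreeVertex), ∀ w, Γ.graph.Adj u w →
        w ∈ ({Sum.inl i, Sum.inl j} : Set TreeVertex) := by
      have one {a b : Fin 6} (hab : Γ.graph.Adj (Sum.inl a) (Sum.inl b)) {w}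
          (hw : Γ.graph.Adj (Sum.inl a) w) : w = Sum.inl b := by
        obtain ⟨v, hv⟩ := hnbr a
        have h1 : Sum.inl b ∈ Γ.graph.neighborSet (Sum.inl a) := hab
        have h2 : w ∈ Γ.graph.neighborSet (Sum.inl a) := hw
        rw [hv] at h1 h2
        exact h2.trans h1.symm
      rintro u (rfl | rfl) w hw
      · exact Or.inr (one hadj hw)
      · exact Or.inl (one hadj.symm hw)
    have := hconn.mem_of_closed hS (Or.inl rfl) (Sum.inr 0)
    simp at this
  have hh (i : Fin 6) : ∃ k : Fin 4, ∀ w, Γ.graph.Adj (Sum.inl i) w ↔ w = Sum.inr k := by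
    obtain ⟨w, hw⟩ := hnbr i
    have hmem (v) : Γ.graph.Adj (Sum.inl i) v ↔ v = w := by
      rw [← SimpleGraph.mem_neighborSet, hw, Set.mem_singleton_iff]
    rcases w with j | k
    · exact absurd ((hmem _).2 rfl) (hll i j)
    · exact ⟨k, hmem⟩
  choose h hh using hh
  have hdeg (k : Fin 4) :
      #{i | h i = k} + #{l | Γ.graph.Adj (Sum.inr k) (Sum.inr l)} = 3 := by
    rw [← Γ.internal_degree k, ncard_neighborSet_eq]
    congr 2
    ext i
    simp only [mem_filter, mem_univ, true_and]
    rw [SimpleGraph.adj_comm, hh, Sum.inr.injEq, eq_comm]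
  -- a vertex without internal neighbor would form a component with its leaves
  have hint (k : Fin 4) : ∃ l : Fin 4, Γ.graph.Adj (Sum.inr k) (Sum.inr l) := by
    by_contra! hno
    have hS : ∀ u ∈ ({u | u = Sum.inr k ∨ Γ.graph.Adj (Sum.inr k) u} : Set TreeVertex), ∀ w,
        Γ.graph.Adj u w → w ∈ ({u | u = Sum.inr k ∨ Γ.graph.Adj (Sum.inr k) u} : Set _) := by
      rintro u (rfl | hu) w hw
      · exact Or.inr hw
      · rcases u with i | l
        · left
          rw [(hh i _).1 hw, ← (hh i _).1 hu.symm]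
        · exact absurd hu (hno l)
    rcases hconn.mem_of_closed hS (Or.inl rfl) (Sum.inr (k + 1)) with h' | h'
    · rw [Sum.inr.injEq] at h'
      exact (by decide : ∀ k : Fin 4, k + 1 ≠ k) k h'
    · exact hno _ h'
  have hcard : ∑ k : Fin 4, #{l : Fin 4 | Γ.graph.Adj (Sum.inr k) (Sum.inr l)} = 6 := by
    have h1 : ∑ k : Fin 4, #{i | h i = k} = 6 := by
      rw [← card_eq_sum_card_fiberwise (fun i _ => mem_univ (h i))]; rfl
    have h2 := sum_congr (rfl : (univ : Finset (Fin 4)) = univ) fun k _ => hdeg k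
    rw [sum_add_distrib, h1] at h2
    simp at h2
    omega
  obtain ⟨star, π, hπ⟩ := exists_skeleton (G := fun k l => Γ.graph.Adj (Sum.inr k) (Sum.inr l))
    (fun k l h => h.symm) (fun k => Γ.graph.loopless.irrefl _) hint hcard
  have htri (ρ : Equiv.Perm (Fin 4)) (hρ : ∀ k l, SkelAdj star k l ↔
      Γ.graph.Adj (Sum.inr (ρ k)) (Sum.inr (ρ l))) :
      TreeCode.IsTrivalent (star, fun i => ρ.symm (h i)) := by
    rw [TreeCode.isTrivalent_iff]
    intro k
    rw [← hdeg (ρ k)]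
    congr 1
    · simp only [Equiv.symm_apply_eq]
    · refine card_equiv ρ fun l => ?_
      simp [hρ]
  obtain ⟨α, hα, hcan⟩ := exists_isCanonical star _ (htri π hπ)
  have hπα (k l) : SkelAdj star k l ↔
      Γ.graph.Adj (Sum.inr ((α.symm.trans π) k)) (Sum.inr ((α.symm.trans π) l)) := by
    have h1 := hα (α.symm k) (α.symm l)
    rw [Equiv.apply_symm_apply, Equiv.apply_symm_apply] at h1
    exact h1.symm.trans (hπ _ _)
  have e (i l) : α (π.symm (h i)) = l ↔ π (α.symm l) = h i := by
    rw [← Equiv.eq_symm_apply, Equiv.symm_apply_eq, eq_comm]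
  refine ⟨_, α.symm.trans π, htri _ hπα, hcan, ?_⟩
  rintro (i | k) (j | l)
  · simpa [treeGraph] using hll i j
  · simp [treeGraph, hh, e]
  · simp only [treeGraph, Sum.map_inl, Sum.map_inr, id]
    rw [SimpleGraph.adj_comm, hh]
    simp [e]
  · exact hπα k l

theorem TreeCode.eq_of_iso {c c' : TreeCode} (hc : c.IsCanonical) (hc' : c'.IsCanonical)
    (π : Equiv.Perm (Fin 4)) (hπ : ∀ u w, (treeGraph c).Adj u w ↔
      (treeGraph c').Adj (Sum.map id π u) (Sum.map id π w)) : c = c' := by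
  obtain ⟨s, h⟩ := c
  obtain ⟨s', h'⟩ := c'
  obtain ⟨rfl, hs⟩ := skelAdj_iso s s' π fun k l => hπ (Sum.inr k) (Sum.inr l)
  have hh : h' = fun i => π (h i) := by
    funext i
    exact (hπ (Sum.inl i) (Sum.inr (h i))).1 rfl
  subst hh
  suffices π = 1 by rw [this]; rfl
  have back {k l : Fin 4} (hp : Precedes h k l) : Precedes (fun i => π (h i)) (π k) (π l) :=
    (precedes_comp_iff π).2 hp
  cases s
  · rcases hs with hs | ⟨h0, h3⟩
    · exact hs
    · have hp : Precedes h 0 3 := hc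
      have hp' : Precedes (fun i => π (h i)) 0 3 := hc'
      have := back hp
      rw [h0, h3] at this
      exact absurd this hp'.asymm
  · obtain ⟨p01, p12⟩ : Precedes h 0 1 ∧ Precedes h 1 2 := hc
    obtain ⟨q01, q12⟩ : Precedes (fun i => π (h i)) 0 1 ∧ Precedes (fun i => π (h i)) 1 2 := hc'
    have q02 := q01.trans q12
    have hq : ∀ k l : Fin 4, k ≠ 3 → l ≠ 3 → k < l → Precedes (fun i => π (h i)) k l := by
      intro k l hk hl hkl
      have : ∀ k l : Fin 4, k ≠ 3 → l ≠ 3 → k < l →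
        (k = 0 ∧ l = 1) ∨ (k = 1 ∧ l = 2) ∨ (k = 0 ∧ l = 2) := by decide
      rcases this k l hk hl hkl with ⟨rfl, rfl⟩ | ⟨rfl, rfl⟩ | ⟨rfl, rfl⟩ <;> assumption
    have hmono : ∀ π : Equiv.Perm (Fin 4), π 3 = 3 → ¬ π 1 < π 0 → ¬ π 2 < π 1 → π = 1 := by
      decide +kernel
    have hπ3 {k : Fin 4} (hk : k ≠ 3) : π k ≠ 3 := fun h => hk (π.injective (h.trans hs.symm))
    exact hmono π hs
      (fun hlt => (hq _ _ (hπ3 (by decide)) (hπ3 (by decide)) hlt).asymm (back p01))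
      (fun hlt => (hq _ _ (hπ3 (by decide)) (hπ3 (by decide)) hlt).asymm (back p12))

/-- The codes of trees, one for each type. -/
def treeCodes : Finset TreeCode := univ.filter fun c => c.IsTrivalent ∧ c.IsCanonical

theorem card_treeCodes : #treeCodes = 105 := by
  decide +kernel

theorem mem_treeCodes {c : TreeCode} : c ∈ treeCodes ↔ c.IsTrivalent ∧ c.IsCanonical := by
  simp [treeCodes]

/-- The type of tree with a given code. -/
def typeOfCode (c : treeCodes) : TreeType :=
  Quotient.mk _ (treeOf c.1 (mem_treeCodes.1 c.2).1)

theorem mk_eq_typeOfCode_iff {Γ : TrivalentTree} {c : treeCodes} :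
    Quotient.mk _ Γ = typeOfCode c ↔ ∃ π, Γ.HasCode c π := by
  rw [eq_comm]
  exact Quotient.eq

theorem bijective_typeOfCode : Bijective typeOfCode := by
  constructor
  · intro c c' h
    obtain ⟨π, hπ⟩ := mk_eq_typeOfCode_iff.1 h.symm
    exact Subtype.ext (TreeCode.eq_of_iso (mem_treeCodes.1 c.2).2 (mem_treeCodes.1 c'.2).2 π hπ)
  · rintro ⟨Γ⟩
    obtain ⟨c, π, h1, h2, h3⟩ := Γ.exists_hasCode
    exact ⟨⟨c, mem_treeCodes.2 ⟨h1, h2⟩⟩, (mk_eq_typeOfCode_iff.2 ⟨π, h3⟩).symm⟩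

theorem card_treeType : Nat.card TreeType = 105 := by
  rw [← Nat.card_eq_of_bijective _ bijective_typeOfCode]
  simp [card_treeCodes]

end Classification

/-! ### Trees of generic pencils are noncrossing -/

section Necessity

/-- All edges between internal vertices of the coded tree define noncrossing splits of the
leaves. -/
def TreeCode.IsNoncrossing (c : TreeCode) : Prop :=
  if c.1 then ∀ k : Fin 4, k ≠ 3 → _root_.IsNoncrossing {i | c.2 i = k}
  else _root_.IsNoncrossing {i | c.2 i = 0} ∧ _root_.IsNoncrossing {i | c.2 i = 0 ∨ c.2 i = 1} ∧
    _root_.IsNoncrossing {i | c.2 i = 3}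

instance : DecidablePred TreeCode.IsNoncrossing := fun c => by
  unfold TreeCode.IsNoncrossing; infer_instance

theorem IsNoncrossing.of_compl {A : Finset (Fin 6)} (h : IsNoncrossing Aᶜ) : IsNoncrossing A := by
  intro i j k l hij hjk hkl hc
  refine h i j k l hij hjk hkl ?_
  simp only [mem_compl, not_iff_not]
  exact hc

/-- The class of the indicator vector of `A`. -/
def indicatorClass (A : Finset (Fin 6)) : TropProj 6 :=
  TropProj.mk fun c => if c ∈ A then 1 else 0

theorem indicatorClass_union {A B : Finset (Fin 6)} (h : Disjoint A B) :
    indicatorClass (A ∪ B) = indicatorClass A + indicatorClass B := by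
  rw [indicatorClass, indicatorClass, indicatorClass, ← map_add]
  congr 1
  ext c
  by_cases hA : c ∈ A
  · simp [hA, disjoint_left.1 h hA]
  · by_cases hB : c ∈ B <;> simp [hA, hB]

theorem indicatorClass_compl (A : Finset (Fin 6)) : indicatorClass Aᶜ = -indicatorClass A := by
  rw [eq_neg_iff_add_eq_zero, indicatorClass, indicatorClass, ← map_add, ← map_zero TropProj.mk,
    TropProj.mk_eq_mk_iff]
  refine ⟨1, fun c => ?_⟩
  by_cases h : c ∈ A <;> simp [h]

theorem ofInt_single (i : Fin 6) : TropProj.ofInt (Pi.single i 1) = indicatorClass {i} := by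
  rw [TropProj.ofInt, indicatorClass]
  congr 1
  ext c
  by_cases h : c = i
  · subst h; simp
  · simp [h]

theorem sum_indicatorClass_singleton (A : Finset (Fin 6)) :
    ∑ i ∈ A, indicatorClass {i} = indicatorClass A := by
  induction A using Finset.induction_on with
  | empty =>
    rw [sum_empty, indicatorClass, ← map_zero TropProj.mk]
    congr 1
  | insert i A hi ih =>
    rw [sum_insert hi, ih, insert_eq, indicatorClass_union (by simpa using hi)]

/-- A primitive integer vector on the ray through the indicator vector of a proper nonempty set is
equal to this indicator vector. -/
theorem ofInt_eq_indicatorClass {u : Fin 6 → ℤ} (hu : IsPrimitiveMod u) {A : Finset (Fin 6)}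
    (hA : A.Nonempty) (hA' : Aᶜ.Nonempty) {r : ℝ} (hr : 0 < r)
    (h : TropProj.ofInt u = r • indicatorClass A) : TropProj.ofInt u = indicatorClass A := by
  rw [TropProj.ofInt, indicatorClass, ← map_smul, TropProj.mk_eq_mk_iff] at h
  obtain ⟨t, ht⟩ := h
  simp only [Pi.smul_apply, smul_eq_mul] at ht
  obtain ⟨i, hi⟩ := hA
  obtain ⟨j, hj⟩ := hA'
  have hti := ht i
  have htj := ht j
  simp only [hi, if_true, mem_compl.1 hj, if_false, mul_one, mul_zero, zero_add] at hti htj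
  have hrm : r = ((u i - u j : ℤ) : ℝ) := by push_cast; linarith
  have hm := hu (u i - u j) (u j) (fun c => if c ∈ A then 1 else 0) (by
    ext c
    have := ht c
    rw [hrm, ← htj] at this
    by_cases hc : c ∈ A
    · simp only [hc, if_true, mul_one] at this
      simp only [Pi.add_apply, Pi.smul_apply, hc, if_true, smul_eq_mul, mul_one, Pi.one_apply]
      exact_mod_cast this
    · simp only [hc, if_false, mul_zero] at this
      simp only [Pi.add_apply, Pi.smul_apply, hc, if_false, smul_eq_mul, mul_one, Pi.one_apply,
        mul_zero]
      exact_mod_cast this)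
  have h1 : r = 1 := by
    rcases hm with hm | hm <;> rw [hm] at hrm
    · simpa using hrm
    · norm_num at hrm
      linarith
  rw [TropProj.ofInt, indicatorClass, TropProj.mk_eq_mk_iff]
  exact ⟨t, fun c => by rw [ht c, h1, one_mul]⟩

section
variable {Γ : TrivalentTree} {c : TreeCode} {π : Equiv.Perm (Fin 4)}

/-- The direction at the vertex `k` of the edge towards `l` in terms of the vertices of the coded
tree. -/
def TropicalLine.edgeDir (L : TropicalLine Γ) (π : Equiv.Perm (Fin 4)) (k l : Fin 4) : TropProj 6 :=
  TropProj.ofInt (L.dir (π k) (Sum.inr (π l)))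

theorem TropicalLine.balanced_code (L : TropicalLine Γ) (hc : Γ.HasCode c π) (k : Fin 4) :
    indicatorClass {i | c.2 i = k} + ∑ l with SkelAdj c.1 k l, L.edgeDir π k l = 0 := by
  classical
  rw [← L.balanced (π k), sum_filter, sum_filter, Fintype.sum_sum_type,
    ← sum_indicatorClass_singleton, sum_filter]
  congr 1
  · refine sum_congr rfl fun i _ => ?_
    have h : c.2 i = k ↔ Γ.graph.Adj (Sum.inr (π k)) (Sum.inl i) := hc (Sum.inr k) (Sum.inl i)
    by_cases hk : c.2 i = k
    · rw [if_pos hk, if_pos (h.1 hk), L.dir_leaf _ _ (h.1 hk), ofInt_single]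
    · rw [if_neg hk, if_neg fun h' => hk (h.2 h')]
  · refine Fintype.sum_equiv π _ _ fun l => ?_
    have h : SkelAdj c.1 k l ↔ Γ.graph.Adj (Sum.inr (π k)) (Sum.inr (π l)) :=
      hc (Sum.inr k) (Sum.inr l)
    by_cases hk : SkelAdj c.1 k l
    · rw [if_pos hk, if_pos (h.1 hk)]; rfl
    · rw [if_neg hk, if_neg fun h' => hk (h.2 h')]

theorem TropicalLine.edgeDir_symm (L : TropicalLine Γ) (hc : Γ.HasCode c π) {k l : Fin 4}
    (hkl : SkelAdj c.1 k l) {A : Finset (Fin 6)} (hA : A.Nonempty) (hA' : Aᶜ.Nonempty)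
    (h : L.edgeDir π k l = indicatorClass A) : L.edgeDir π l k = indicatorClass Aᶜ := by
  have hadj : Γ.graph.Adj (Sum.inr (π k)) (Sum.inr (π l)) := (hc (Sum.inr k) (Sum.inr l)).1 hkl
  obtain ⟨t, ht, h1⟩ := L.dir_edge _ _ hadj
  obtain ⟨t', ht', h2⟩ := L.dir_edge _ _ hadj.symm
  rw [TropicalLine.edgeDir] at h
  rw [h] at h1
  refine ofInt_eq_indicatorClass (L.dir_primitive _ _ hadj.symm) hA' (by rwa [compl_compl])
    (div_pos ht ht') ?_
  have h3 : t' • TropProj.ofInt (L.dir (π l) (Sum.inr (π k))) = t • indicatorClass Aᶜ := by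
    rw [← h2, indicatorClass_compl, smul_neg, ← h1, neg_sub]
  rw [div_eq_inv_mul, mul_smul, ← h3, inv_smul_smul₀ ht'.ne']

theorem TropicalLine.isNoncrossing_of_edgeDir (L : TropicalLine Γ) (hc : Γ.HasCode c π)
    {x : Fin 4 → Fin 3 → ℝ} (hx : IsGenericConfig x)
    (hL : L.carrier = conicPencil fun s => TropProj.mk (x s)) {k l : Fin 4}
    (hkl : SkelAdj c.1 k l) {A : Finset (Fin 6)} (h : L.edgeDir π k l = indicatorClass A) :
    IsNoncrossing A := by
  have hadj : Γ.graph.Adj (Sum.inr (π k)) (Sum.inr (π l)) := (hc (Sum.inr k) (Sum.inr l)).1 hkl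
  obtain ⟨t, ht, h1⟩ := L.dir_edge _ _ hadj
  rw [TropicalLine.edgeDir] at h
  rw [h] at h1
  obtain ⟨a, ha⟩ := Submodule.Quotient.mk_surjective _ (L.pos (π k))
  refine isNoncrossing_of_segment hx (a := a) ht fun τ h0 hτ => ?_
  rw [← mk_mem_conicPencil_iff, ← hL]
  refine ⟨π k, Sum.inr (π l), hadj, ?_⟩
  rw [edgeCell, segment_eq_image']
  refine ⟨τ / t, ⟨by positivity, (div_le_one ht).2 hτ⟩, ?_⟩
  change L.pos (π k) + (τ / t) • (L.pos (π l) - L.pos (π k)) = _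
  rw [h1, ← mul_smul, div_mul_cancel₀ _ ht.ne', ← ha, indicatorClass, ← map_smul]
  change TropProj.mk a + _ = _
  rw [← map_add]
  congr 1
  ext i
  by_cases hi : i ∈ A <;> simp [hi]

/-- By the balancing condition, the direction of an edge is the indicator vector of the set of
leaves on its far side. -/
theorem TropicalLine.isNoncrossing_code (L : TropicalLine Γ) (hc : Γ.HasCode c π)
    (htri : c.IsTrivalent) {x : Fin 4 → Fin 3 → ℝ} (hx : IsGenericConfig x)
    (hL : L.carrier = conicPencil fun s => TropProj.mk (x s)) : c.IsNoncrossing := by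
  have outer (k l : Fin 4) (hkl : ∀ m, SkelAdj c.1 k m ↔ m = l) :
      L.edgeDir π k l = indicatorClass (univ.filter fun i => c.2 i = k)ᶜ := by
    have h := L.balanced_code hc k
    have : (univ.filter fun m => SkelAdj c.1 k m) = {l} := by ext m; simp [hkl]
    rw [this, sum_singleton] at h
    rw [indicatorClass_compl]
    exact eq_neg_of_add_eq_zero_right h
  have outer' (k l : Fin 4) (hkl : ∀ m, SkelAdj c.1 k m ↔ m = l) :
      _root_.IsNoncrossing {i | c.2 i = k} :=
    (L.isNoncrossing_of_edgeDir hc hx hL ((hkl l).2 rfl) (outer k l hkl)).of_compl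
  obtain ⟨_ | _, h⟩ := c
  · refine ⟨outer' 0 1 (by decide : ∀ m, SkelAdj false 0 m ↔ m = 1), ?_,
      outer' 3 2 (by decide : ∀ m, SkelAdj false 3 m ↔ m = 2)⟩
    obtain ⟨-, -, h0, h3⟩ : leafCount h 1 = 1 ∧ leafCount h 2 = 1 ∧ leafCount h 0 = 2 ∧
      leafCount h 3 = 2 := htri
    rw [leafCount_eq] at h0 h3
    have e01 := outer 0 1 (by decide : ∀ m, SkelAdj false 0 m ↔ m = 1)
    have e10 := L.edgeDir_symm hc (by decide : SkelAdj false 0 1) (by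
        obtain ⟨i, hi⟩ := card_pos.1 (by omega : 0 < #{i | h i = 3})
        refine ⟨i, ?_⟩
        simp only [mem_filter, mem_univ, true_and] at hi
        simp [hi]) (by
        rw [compl_compl]
        exact card_pos.1 (by simp only; omega)) e01
    rw [compl_compl] at e10
    have hb := L.balanced_code hc 1
    have hs : (univ.filter fun m => SkelAdj false 1 m) = {0, 2} := by decide
    rw [hs, sum_pair (by decide), e10, ← add_assoc, ← indicatorClass_union (by
      rw [disjoint_left]
      intro i hi hi'
      simp only [mem_filter, mem_univ, true_and] at hi hi'
      rw [hi] at hi'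
      exact absurd hi' (by decide))] at hb
    have e12 := eq_neg_of_add_eq_zero_right hb
    rw [← indicatorClass_compl] at e12
    have := (L.isNoncrossing_of_edgeDir hc hx hL (by decide : SkelAdj false 1 2) e12).of_compl
    convert this using 1
    ext i
    simp [or_comm]
  · intro k hk
    exact outer' k 3 ((by decide : ∀ k : Fin 4, k ≠ 3 → ∀ m, SkelAdj true k m ↔ m = 3) k hk)

end

end Necessity

/-! ### Tropical lines from vertex positions -/

section Embedding

theorem skelNext_rev : ∀ {s : Bool} {k l : Fin 4}, SkelAdj s k l → ∀ m,
    (m ≠ l ∧ skelNext s l m = k) ↔ ¬ (m ≠ k ∧ skelNext s k m = l) := by decide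

theorem skelAdj_skelNext : ∀ (s : Bool) {k m : Fin 4}, m ≠ k → SkelAdj s k (skelNext s k m) := by
  decide

theorem skelNext_skelNext_ne : ∀ {s : Bool} {k m : Fin 4}, m ≠ k → m ≠ skelNext s k m →
    skelNext s (skelNext s k m) m ≠ k := by decide

/-- If each vertex of a path or star points to one of its neighbors, then two neighbors point to
each other. -/
theorem exists_mutual : ∀ (s : Bool) (g : Fin 4 → Fin 4), (∀ k, SkelAdj s k (g k)) →
    ∃ k, g (g k) = k := by decide +kernel

/-- The neighbor of the internal vertex `k` on the way to the leaf `i`. -/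
def TreeCode.branch (c : TreeCode) (k : Fin 4) (i : Fin 6) : TreeVertex :=
  if c.2 i = k then Sum.inl i else Sum.inr (skelNext c.1 k (c.2 i))

variable {c : TreeCode}

theorem TreeCode.branch_eq_inr_iff {k l : Fin 4} {i : Fin 6} :
    c.branch k i = Sum.inr l ↔ c.2 i ≠ k ∧ skelNext c.1 k (c.2 i) = l := by
  unfold TreeCode.branch
  by_cases h : c.2 i = k <;> simp [h]

theorem TreeCode.branch_eq_inl_iff {k : Fin 4} {i j : Fin 6} :
    c.branch k i = Sum.inl j ↔ c.2 j = k ∧ i = j := by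
  unfold TreeCode.branch
  by_cases h : c.2 i = k
  · simp only [h, if_true, Sum.inl.injEq]
    exact ⟨fun h' => ⟨h' ▸ h, h'⟩, fun h' => h'.2⟩
  · simp only [h, if_false, reduceCtorEq, false_iff]
    rintro ⟨h1, rfl⟩
    exact h h1

theorem TreeCode.branch_rev {k l : Fin 4} (h : SkelAdj c.1 k l) (i : Fin 6) :
    c.branch l i = Sum.inr k ↔ c.branch k i ≠ Sum.inr l := by
  rw [Ne, TreeCode.branch_eq_inr_iff, TreeCode.branch_eq_inr_iff]
  exact skelNext_rev h _

theorem TreeCode.adj_branch (k : Fin 4) (i : Fin 6) :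
    (treeGraph c).Adj (Sum.inr k) (c.branch k i) := by
  unfold TreeCode.branch
  by_cases h : c.2 i = k
  · rw [if_pos h]; exact h
  · rw [if_neg h]; exact skelAdj_skelNext c.1 h

theorem TreeCode.exists_branch_eq (hc : c.IsTrivalent) {k : Fin 4} {w : TreeVertex}
    (hw : (treeGraph c).Adj (Sum.inr k) w) : ∃ i, c.branch k i = w := by
  rcases w with i | l
  · exact ⟨i, TreeCode.branch_eq_inl_iff.2 ⟨hw, rfl⟩⟩
  · have hl : SkelAdj c.1 k l := hw
    have key : ∀ s k l, SkelAdj s k l → ∃ m, m ≠ k ∧ skelNext s k m = l ∧ (s = true → m ≠ 3) := by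
      decide
    obtain ⟨m, hm, hml, hm3⟩ := key _ _ _ hl
    have hpos : 0 < leafCount c.2 m := by
      obtain ⟨_ | _, h⟩ := c
      · obtain ⟨h1, h2, h0, h3⟩ : leafCount h 1 = 1 ∧ leafCount h 2 = 1 ∧ leafCount h 0 = 2 ∧
          leafCount h 3 = 2 := hc
        fin_cases m <;> simp [*]
      · obtain ⟨h3, h0, h1, h2⟩ : leafCount h 3 = 0 ∧ leafCount h 0 = 2 ∧ leafCount h 1 = 2 ∧
          leafCount h 2 = 2 := hc
        have := hm3 rfl
        fin_cases m <;> simp_all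
    rw [leafCount_eq, card_pos] at hpos
    obtain ⟨i, hi⟩ := hpos
    have hi : c.2 i = m := by simpa using hi
    exact ⟨i, TreeCode.branch_eq_inr_iff.2 (by rw [hi]; exact ⟨hm, hml⟩)⟩

/-- There are at least three branches at an internal vertex. -/
theorem TreeCode.exists_branch_ne (hc : c.IsTrivalent) (k : Fin 4) (w w' : TreeVertex) :
    ∃ i, c.branch k i ≠ w ∧ c.branch k i ≠ w' := by
  by_contra! h
  have hsub : (treeGraph c).neighborSet (Sum.inr k) ⊆ {w, w'} := by
    intro v hv
    obtain ⟨i, rfl⟩ := TreeCode.exists_branch_eq hc hv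
    by_cases hi : c.branch k i = w
    · exact Or.inl hi
    · exact Or.inr (h i hi)
  have h1 := Set.ncard_le_ncard hsub
  have h2 := Set.ncard_insert_le w {w'}
  rw [ncard_treeGraph_neighborSet_inr hc] at h1
  rw [Set.ncard_singleton] at h2
  omega

/-- Vertex positions `v` in homogeneous coordinates for an embedding of the coded tree: the vector
from `k` to another vertex `m` is constant on the leaves outside the branch of `m` at `k`, and
larger on the leaves of this branch. -/
structure TreeCode.IsEmbeddingData (c : TreeCode) (v : Fin 4 → Fin 6 → ℝ) : Prop where
  eq_of_ne : ∀ k m, m ≠ k → ∀ i j, c.branch k i ≠ Sum.inr (skelNext c.1 k m) →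
    c.branch k j ≠ Sum.inr (skelNext c.1 k m) → v m i - v k i = v m j - v k j
  lt_of_eq : ∀ k m, m ≠ k → ∀ i j, c.branch k i = Sum.inr (skelNext c.1 k m) →
    c.branch k j ≠ Sum.inr (skelNext c.1 k m) → v m j - v k j < v m i - v k i

variable {v : Fin 4 → Fin 6 → ℝ}

theorem TreeCode.IsEmbeddingData.exists_length (hv : c.IsEmbeddingData v) (hc : c.IsTrivalent)
    {k l : Fin 4} (hkl : SkelAdj c.1 k l) : ∃ T > 0, ∃ r, ∀ i,
      v l i = v k i + (if c.branch k i = Sum.inr l then T else 0) + r := by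
  obtain ⟨i₀, hi₀⟩ := TreeCode.exists_branch_eq (w := Sum.inr l) hc hkl
  obtain ⟨j₀, hj₀, -⟩ := TreeCode.exists_branch_ne hc k (Sum.inr l) (Sum.inr l)
  have hlk := hkl.symm
  refine ⟨(v l i₀ - v k i₀) - (v l j₀ - v k j₀), sub_pos.2 (hv.lt_of_eq k l hkl.1.symm i₀ j₀
    (by rw [hkl.2, hi₀]) (by rwa [hkl.2])), v l j₀ - v k j₀, fun i => ?_⟩
  by_cases hi : c.branch k i = Sum.inr l
  · have h (i) (hi : c.branch k i = Sum.inr l) : c.branch l i ≠ Sum.inr (skelNext c.1 l k) := by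
      rw [hlk.2, Ne, TreeCode.branch_rev hkl]
      exact fun h => h hi
    have := hv.eq_of_ne l k hkl.1 i i₀ (h i hi) (h i₀ hi₀)
    rw [if_pos hi]
    linarith
  · have := hv.eq_of_ne k l hkl.1.symm i j₀ (by rwa [hkl.2]) (by rwa [hkl.2])
    rw [if_neg hi]
    linarith

theorem TreeCode.mem_edgeCell_inl_iff {k : Fin 4} {i : Fin 6} (hi : c.2 i = k) {p : TropProj 6} :
    p ∈ edgeCell (fun k => TropProj.mk (v k)) k (Sum.inl i) ↔ ∃ τ : ℝ, 0 ≤ τ ∧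
      p = TropProj.mk fun j => v k j + if c.branch k j = Sum.inl i then τ else 0 := by
  refine exists_congr fun τ => and_congr_right fun _ => ?_
  have : TropProj.mk (v k) + τ • TropProj.ofInt (Pi.single i 1) =
      TropProj.mk fun j => v k j + if c.branch k j = Sum.inl i then τ else 0 := by
    rw [TropProj.ofInt, ← map_smul, ← map_add]
    congr 1
    ext j
    by_cases h : j = i
    · subst h; simp [TreeCode.branch, hi]
    · have : c.branch k j ≠ Sum.inl i := fun h' => h (TreeCode.branch_eq_inl_iff.1 h').2
      simp [this, h]
  rw [this]

theorem TreeCode.mem_edgeCell_inr_iff {k l : Fin 4} {T r : ℝ} (hT : 0 < T)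
    (h : ∀ i, v l i = v k i + (if c.branch k i = Sum.inr l then T else 0) + r) {p : TropProj 6} :
    p ∈ edgeCell (fun k => TropProj.mk (v k)) k (Sum.inr l) ↔ ∃ τ : ℝ, 0 ≤ τ ∧ τ ≤ T ∧
      p = TropProj.mk fun j => v k j + if c.branch k j = Sum.inr l then τ else 0 := by
  have key (θ : ℝ) : TropProj.mk (v k) + θ • (TropProj.mk (v l) - TropProj.mk (v k)) =
      TropProj.mk fun j => v k j + if c.branch k j = Sum.inr l then θ * T else 0 := by
    rw [← map_sub, ← map_smul, ← map_add, TropProj.mk_eq_mk_iff]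
    refine ⟨θ * r, fun j => ?_⟩
    simp only [Pi.add_apply, Pi.smul_apply, Pi.sub_apply, smul_eq_mul, h j]
    by_cases hj : c.branch k j = Sum.inr l <;> simp [hj]
    ring
  rw [edgeCell, segment_eq_image']
  constructor
  · rintro ⟨θ, ⟨h0, h1⟩, rfl⟩
    exact ⟨θ * T, by positivity, by nlinarith, key θ⟩
  · rintro ⟨τ, h0, h1, rfl⟩
    refine ⟨τ / T, ⟨by positivity, (div_le_one hT).2 h1⟩, ?_⟩
    rw [← div_mul_cancel₀ τ hT.ne']
    simpa [hT.ne'] using key (τ / T)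

theorem edgeCell_inr_symm (pos : Fin 4 → TropProj 6) (k l : Fin 4) :
    edgeCell pos k (Sum.inr l) = edgeCell pos l (Sum.inr k) :=
  segment_symm ℝ _ _

/-- The vector `a - v u` is constant on the leaves outside the branch `w` at `u`. -/
def TreeCode.ConstOff (c : TreeCode) (v : Fin 4 → Fin 6 → ℝ) (a : Fin 6 → ℝ) (u : Fin 4)
    (w : TreeVertex) : Prop :=
  ∀ i j, c.branch u i ≠ w → c.branch u j ≠ w → a i - v u i = a j - v u j

theorem TreeCode.constOff_of_mem (hv : c.IsEmbeddingData v) (hc : c.IsTrivalent) {k : Fin 4}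
    {w : TreeVertex} (hw : (treeGraph c).Adj (Sum.inr k) w) {a : Fin 6 → ℝ}
    (ha : TropProj.mk a ∈ edgeCell (fun k => TropProj.mk (v k)) k w) (u : Fin 4) :
    c.ConstOff v a u (if k = u then w else Sum.inr (skelNext c.1 u k)) := by
  obtain ⟨τ, t, hat⟩ : ∃ τ t : ℝ, ∀ i, a i = v k i + (if c.branch k i = w then τ else 0) + t := by
    rcases w with i | l
    · obtain ⟨τ, -, h⟩ := (TreeCode.mem_edgeCell_inl_iff (c := c) hw).1 ha
      exact ⟨τ, TropProj.mk_eq_mk_iff.1 h⟩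
    · obtain ⟨T, hT, r, h⟩ := hv.exists_length hc hw
      obtain ⟨τ, -, -, h⟩ := (TreeCode.mem_edgeCell_inr_iff (c := c) hT h).1 ha
      exact ⟨τ, TropProj.mk_eq_mk_iff.1 h⟩
  intro i j
  by_cases hku : k = u
  · subst hku
    intro hi hj
    rw [if_pos rfl] at hi hj
    rw [hat, hat, if_neg hi, if_neg hj]
    ring
  · rw [if_neg hku]
    intro hi hj
    have h1 := hv.eq_of_ne u k hku i j hi hj
    -- the leaves outside the branch of `k` at `u` lie in the same branch at `k`
    have same (i) (hi : c.branch u i ≠ Sum.inr (skelNext c.1 u k)) :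
        c.branch k i = Sum.inr (skelNext c.1 k u) := by
      rw [Ne, TreeCode.branch_eq_inr_iff] at hi
      rw [TreeCode.branch_eq_inr_iff]
      have key : ∀ (s : Bool) (k u m : Fin 4), k ≠ u →
          ¬ (m ≠ u ∧ skelNext s u m = skelNext s u k) →
          m ≠ k ∧ skelNext s k m = skelNext s k u := by decide
      exact key _ _ _ _ hku hi
    rw [hat, hat, same i hi, same j hj]
    linarith

theorem TreeCode.eq_pos_of_constOff (hc : c.IsTrivalent) {a : Fin 6 → ℝ} {u : Fin 4}
    {w w' : TreeVertex} (hww : w ≠ w') (h : c.ConstOff v a u w) (h' : c.ConstOff v a u w') :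
    TropProj.mk a = TropProj.mk (v u) := by
  obtain ⟨l, hl, hl'⟩ := TreeCode.exists_branch_ne hc u w w'
  refine TropProj.mk_eq_mk_iff.2 ⟨a l - v u l, fun i => ?_⟩
  by_cases hi : c.branch u i = w
  · have := h' i l (fun h => hww (hi.symm.trans h)) hl'
    linarith
  · have := h i l hi hl
    linarith

theorem TreeCode.exists_eq_pos_of_mem (hv : c.IsEmbeddingData v) (hc : c.IsTrivalent)
    {k k' : Fin 4} {w w' : TreeVertex} (hw : (treeGraph c).Adj (Sum.inr k) w)
    (hw' : (treeGraph c).Adj (Sum.inr k') w') (hne : s(Sum.inr k, w) ≠ s(Sum.inr k', w'))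
    {a : Fin 6 → ℝ} (ha : TropProj.mk a ∈ edgeCell (fun k => TropProj.mk (v k)) k w)
    (ha' : TropProj.mk a ∈ edgeCell (fun k => TropProj.mk (v k)) k' w') :
    ∃ j, TropProj.mk a = TropProj.mk (v j) ∧ Sum.inr j ∈ s(Sum.inr k, w) := by
  by_cases hkk : k' = k
  · subst hkk
    have h1 := TreeCode.constOff_of_mem hv hc hw ha k'
    have h2 := TreeCode.constOff_of_mem hv hc hw' ha' k'
    rw [if_pos rfl] at h1 h2
    exact ⟨k', TreeCode.eq_pos_of_constOff hc (fun h => hne (by rw [h])) h1 h2,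
      Sym2.mem_mk_left _ _⟩
  by_cases hnear : w = Sum.inr (skelNext c.1 k k')
  · -- the other end of the first edge separates it from the second edge
    subst hnear
    set l := skelNext c.1 k k' with hl
    have hadj : SkelAdj c.1 k l := hw
    rw [edgeCell_inr_symm] at ha
    have h1 := TreeCode.constOff_of_mem hv hc (w := Sum.inr k) hadj.symm ha l
    have h2 := TreeCode.constOff_of_mem hv hc hw' ha' l
    rw [if_pos rfl] at h1
    refine ⟨l, TreeCode.eq_pos_of_constOff hc ?_ h1 h2, Sym2.mem_mk_right _ _⟩
    by_cases hlk : k' = l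
    · rw [if_pos hlk]
      rintro rfl
      exact hne (by rw [hlk, Sym2.eq_swap])
    · rw [if_neg hlk]
      intro h
      exact skelNext_skelNext_ne hkk hlk (Sum.inr_injective h).symm
  · have h1 := TreeCode.constOff_of_mem hv hc hw ha k
    have h2 := TreeCode.constOff_of_mem hv hc hw' ha' k
    rw [if_pos rfl] at h1
    rw [if_neg hkk] at h2
    exact ⟨k, TreeCode.eq_pos_of_constOff hc hnear h1 h2, Sym2.mem_mk_left _ _⟩

theorem TreeCode.IsEmbeddingData.pos_injective (hv : c.IsEmbeddingData v) (hc : c.IsTrivalent) :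
    Injective fun k => TropProj.mk (v k) := by
  intro k m hkm
  by_contra hne
  have hadj := skelAdj_skelNext c.1 (Ne.symm hne)
  obtain ⟨i, hi⟩ := TreeCode.exists_branch_eq (w := Sum.inr _) hc hadj
  obtain ⟨j, hj, -⟩ := TreeCode.exists_branch_ne hc k (Sum.inr (skelNext c.1 k m)) (Sum.inl 0)
  have hlt := hv.lt_of_eq k m (Ne.symm hne) i j hi hj
  obtain ⟨t, ht⟩ := TropProj.mk_eq_mk_iff.1 hkm
  linarith [ht i, ht j]

/-- The direction of an edge: the indicator vector of the leaves on its far side. -/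
def TreeCode.direction (c : TreeCode) (k : Fin 4) (w : TreeVertex) : Fin 6 → ℤ :=
  fun i => if c.branch k i = w then 1 else 0

/-- The tropical line with given vertex positions. -/
def TreeCode.IsEmbeddingData.line (hv : c.IsEmbeddingData v) (hc : c.IsTrivalent) :
    TropicalLine (treeOf c hc) where
  pos k := TropProj.mk (v k)
  dir := c.direction
  pos_injective := hv.pos_injective hc
  dir_primitive := by
    intro k w hw m t u h
    obtain ⟨i, hi⟩ := TreeCode.exists_branch_eq hc hw
    obtain ⟨j, hj, -⟩ := TreeCode.exists_branch_ne hc k w w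
    have h1 := congrFun h i
    have h2 := congrFun h j
    simp only [TreeCode.direction, hi, hj, if_true, if_false, Pi.add_apply, Pi.smul_apply,
      smul_eq_mul, Pi.one_apply, mul_one] at h1 h2
    have : m * (u i - u j) = 1 := by linarith
    exact Int.eq_one_or_neg_one_of_mul_eq_one this
  dir_leaf := by
    intro k i hi
    have hi : c.2 i = k := hi
    ext j
    rw [TreeCode.direction]
    by_cases h : j = i
    · subst h; simp [TreeCode.branch, hi]
    · have : c.branch k j ≠ Sum.inl i := fun h' => h (TreeCode.branch_eq_inl_iff.1 h').2
      simp [this, h]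
  dir_edge := by
    intro k l hkl
    obtain ⟨T, hT, r, h⟩ := hv.exists_length hc hkl
    refine ⟨T, hT, ?_⟩
    rw [TropProj.ofInt, ← map_sub, ← map_smul, TropProj.mk_eq_mk_iff]
    refine ⟨r, fun i => ?_⟩
    simp only [Pi.sub_apply, Pi.smul_apply, smul_eq_mul, h i, TreeCode.direction]
    by_cases hi : c.branch k i = Sum.inr l <;> simp [hi]
    ring
  balanced := by
    classical
    intro k
    simp only [TropProj.ofInt]
    rw [← map_sum, ← map_zero TropProj.mk, TropProj.mk_eq_mk_iff]
    refine ⟨1, fun i => ?_⟩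
    rw [Finset.sum_apply, sum_eq_single (c.branch k i)]
    · simp [TreeCode.direction]
    · intro w _ hw
      simp [TreeCode.direction, hw.symm]
    · intro h
      refine absurd ?_ h
      rw [mem_filter]
      exact ⟨mem_univ _, TreeCode.adj_branch k i⟩
  embedded := by
    rintro k w k' w' hw hw' hne p ⟨hp, hp'⟩
    obtain ⟨a, rfl⟩ := Submodule.Quotient.mk_surjective _ p
    obtain ⟨j, hj, hjm⟩ := TreeCode.exists_eq_pos_of_mem hv hc hw hw' hne hp hp'
    obtain ⟨j', hj', hjm'⟩ := TreeCode.exists_eq_pos_of_mem hv hc hw' hw hne.symm hp' hp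
    have : j = j' := hv.pos_injective hc (hj.symm.trans hj')
    subst this
    exact ⟨j, hj, hjm, hjm'⟩

end Embedding

/-! ### Pencils that are tropical lines -/

section Sufficiency

variable {c : TreeCode} {v : Fin 4 → Fin 6 → ℝ} {x : Fin 4 → Fin 3 → ℝ}

/-- The edges of the embedded tree lie in the pencil because at each of the points a pair of
monomials on the same side of the edge is minimizing at both ends of the edge. -/
structure TreeCode.IsPencilData (c : TreeCode) (v : Fin 4 → Fin 6 → ℝ)
    (x : Fin 4 → Fin 3 → ℝ) : Prop where
  edge : ∀ k l, SkelAdj c.1 k l → ∀ s, ∃ i j, i ≠ j ∧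
    (c.branch k i = Sum.inr l ↔ c.branch k j = Sum.inr l) ∧
    (IsTight (fun s i => conicMatrix x s i + v k i) s i ∧
      IsTight (fun s i => conicMatrix x s i + v k i) s j) ∧
    (IsTight (fun s i => conicMatrix x s i + v l i) s i ∧
      IsTight (fun s i => conicMatrix x s i + v l i) s j)
  ray : ∀ m s, ∃ i j, i ≠ j ∧ i ≠ m ∧ j ≠ m ∧
    IsTight (fun s i => conicMatrix x s i + v (c.2 m) i) s i ∧
    IsTight (fun s i => conicMatrix x s i + v (c.2 m) i) s j

theorem TreeCode.IsPencilData.inPencil_ray (hx : c.IsPencilData v x) (m : Fin 6) {τ : ℝ}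
    (hτ : 0 ≤ τ) :
    InPencil x fun j => v (c.2 m) j + if c.branch (c.2 m) j = Sum.inl m then τ else 0 := by
  intro s
  obtain ⟨i, j, hij, him, hjm, hi, hj⟩ := hx.ray m s
  have key (i) (him : i ≠ m) (hi : IsTight (fun s i => conicMatrix x s i + v (c.2 m) i) s i) :
      IsTight (fun s j => conicMatrix x s j + (v (c.2 m) j +
        if c.branch (c.2 m) j = Sum.inl m then τ else 0)) s i := by
    intro d
    have hb : c.branch (c.2 m) i ≠ Sum.inl m := fun h => him (TreeCode.branch_eq_inl_iff.1 h).2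
    have := hi d
    simp only [hb, if_false]
    by_cases h : c.branch (c.2 m) d = Sum.inl m <;> simp only [h, if_true, if_false] <;> linarith
  exact ⟨i, j, hij, key i him hi, key j hjm hj⟩

theorem TreeCode.IsPencilData.inPencil_edge (hx : c.IsPencilData v x) {k l : Fin 4}
    (hkl : SkelAdj c.1 k l) {T r τ : ℝ}
    (h : ∀ i, v l i = v k i + (if c.branch k i = Sum.inr l then T else 0) + r)
    (h0 : 0 ≤ τ) (h1 : τ ≤ T) :
    InPencil x fun j => v k j + if c.branch k j = Sum.inr l then τ else 0 := by
  intro s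
  obtain ⟨i, j, hij, hb, ⟨hki, hkj⟩, hli, hlj⟩ := hx.edge k l hkl s
  have key (i) (hki : IsTight (fun s i => conicMatrix x s i + v k i) s i)
      (hli : IsTight (fun s i => conicMatrix x s i + v l i) s i) :
      IsTight (fun s j => conicMatrix x s j + (v k j +
        if c.branch k j = Sum.inr l then τ else 0)) s i := by
    intro d
    have e1 := hki d
    have e2 := hli d
    simp only [h] at e2
    by_cases hi : c.branch k i = Sum.inr l <;> by_cases hd : c.branch k d = Sum.inr l <;>
      simp only [hi, hd, if_true, if_false] at e2 ⊢ <;> linarith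
  exact ⟨i, j, hij, key i hki hli, key j hkj hlj⟩

/-- The point `a` lies in the closed cone of the branch `w` at the vertex `k`. -/
def TreeCode.PointsTo (c : TreeCode) (v : Fin 4 → Fin 6 → ℝ) (a : Fin 6 → ℝ) (k : Fin 4)
    (w : TreeVertex) : Prop :=
  ∃ m, ∀ i, v k i + m ≤ a i ∧ (c.branch k i ≠ w → a i = v k i + m)

/-- The circuits of the pencil on three leaves in different branches at a vertex are centered at
this vertex. -/
theorem TreeCode.exists_le_of_inPencil (hv : c.IsEmbeddingData v)
    (hx : c.IsPencilData v x) (hgen : GenericMinors (conicMatrix x)) {a : Fin 6 → ℝ}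
    (ha : InPencil x a) (k : Fin 4) {i j l : Fin 6} (hij : c.branch k i ≠ c.branch k j)
    (hil : c.branch k i ≠ c.branch k l) (hjl : c.branch k j ≠ c.branch k l) :
    a j - v k j ≤ a i - v k i ∨ a l - v k l ≤ a i - v k i := by
  have hij' : i ≠ j := fun h => hij (by rw [h])
  have hil' : i ≠ l := fun h => hil (by rw [h])
  have hjl' : j ≠ l := fun h => hjl (by rw [h])
  have hcard : #({i, j, l} : Finset (Fin 6)) = 3 := by
    rw [card_insert_of_notMem (by simp [hij', hil']), card_pair hjl']
  obtain ⟨p, hp⟩ := hgen.exists_circuit {i, j, l} (by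
    rw [card_compl, hcard]; rfl)
  -- comparison of `i` and `j` far out on the ray of a third leaf `l`
  have le (i j l : Fin 6) (hT : ∀ d, d ∈ ({i, j, l} : Finset (Fin 6)) → d = i ∨ d = j ∨ d = l)
      (hp : ∀ a, InPencil x a → ∃ d ∈ ({i, j, l} : Finset (Fin 6)), d ≠ i ∧ a d + p d ≤ a i + p i)
      (hil : c.branch k i ≠ c.branch k l) (hjl : c.branch k j ≠ c.branch k l) :
      v k j + p j ≤ v k i + p i := by
    have hil' : i ≠ l := fun h => hil (by rw [h])
    have hjl' : j ≠ l := fun h => hjl (by rw [h])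
    set m := c.2 l with hm
    have hR : 0 ≤ |v m i + p i - v m l - p l| + 1 := by positivity
    obtain ⟨d, hd, hdi, hle⟩ := hp _ (hx.inPencil_ray l hR)
    have hbi : c.branch m i ≠ Sum.inl l := fun h => hil' (TreeCode.branch_eq_inl_iff.1 h).2
    have hbj : c.branch m j ≠ Sum.inl l := fun h => hjl' (TreeCode.branch_eq_inl_iff.1 h).2
    have hbl : c.branch m l = Sum.inl l := TreeCode.branch_eq_inl_iff.2 ⟨rfl, rfl⟩
    have hmij : v m j + p j ≤ v m i + p i := by
      rcases hT d hd with rfl | rfl | rfl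
      · exact absurd rfl hdi
      · simpa [← hm, hbi, hbj] using hle
      · simp only [← hm, hbi, hbl, if_true, if_false] at hle
        linarith [le_abs_self (v m i + p i - v m d - p d)]
    by_cases hmk : m = k
    · rwa [hmk] at hmij
    · have hb : c.branch k l = Sum.inr (skelNext c.1 k m) :=
        TreeCode.branch_eq_inr_iff.2 ⟨hmk, rfl⟩
      have := hv.eq_of_ne k m hmk i j (hb ▸ hil) (hb ▸ hjl)
      linarith
  have perm {i' j' l' : Fin 6} (h : ({i', j', l'} : Finset (Fin 6)) = {i, j, l}) (a)
      (ha : InPencil x a) : ∃ d ∈ ({i', j', l'} : Finset (Fin 6)),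
        d ≠ i' ∧ a d + p d ≤ a i' + p i' := by
    rw [h]
    exact hp a ha i' (h ▸ mem_insert_self _ _)
  have p1 := le i j l (by simp) (perm rfl) hil hjl
  have p2 := le j i l (by simp) (perm (by ext; simp; tauto)) hjl hil
  have p3 := le i l j (by simp) (perm (by ext; simp; tauto)) hij hjl.symm
  have p4 := le l i j (by simp) (perm (by ext; simp; tauto)) hjl.symm hij
  obtain ⟨d, hd, hdi, hle⟩ := hp a ha i (by simp)
  simp only [mem_insert, mem_singleton] at hd
  rcases hd with rfl | rfl | rfl
  · exact absurd rfl hdi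
  · left; linarith
  · right; linarith

theorem TreeCode.exists_pointsTo (hc : c.IsTrivalent) (hv : c.IsEmbeddingData v)
    (hx : c.IsPencilData v x) (hgen : GenericMinors (conicMatrix x)) {a : Fin 6 → ℝ}
    (ha : InPencil x a) (k : Fin 4) :
    ∃ w, (treeGraph c).Adj (Sum.inr k) w ∧ c.PointsTo v a k w := by
  have tri {i j l : Fin 6} := TreeCode.exists_le_of_inPencil hv hx hgen ha k (i := i) (j := j)
    (l := l)
  obtain ⟨i₀, h0⟩ := Finite.exists_min fun i => a i - v k i
  by_cases hall : ∀ i, a i - v k i = a i₀ - v k i₀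
  · refine ⟨_, TreeCode.adj_branch k 0, a i₀ - v k i₀, fun i => ⟨?_, fun _ => ?_⟩⟩ <;>
      linarith [hall i]
  push Not at hall
  obtain ⟨i₁, h1⟩ := hall
  have h1 : a i₀ - v k i₀ < a i₁ - v k i₁ := lt_of_le_of_ne (h0 i₁) h1.symm
  refine ⟨_, TreeCode.adj_branch k i₁, a i₀ - v k i₀, fun i => ⟨by linarith [h0 i], fun hi => ?_⟩⟩
  by_contra hne
  have h2 : a i₀ - v k i₀ < a i - v k i :=
    lt_of_le_of_ne (h0 i) fun h => hne (by linarith)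
  -- then no leaf of the third branch attains the minimum either
  have h3 (l) (hl : c.branch k l ≠ c.branch k i) (hl' : c.branch k l ≠ c.branch k i₁) :
      a i₀ - v k i₀ < a l - v k l := by
    rcases tri hl hl' hi with h | h <;> linarith
  obtain ⟨l, hl, hl'⟩ := TreeCode.exists_branch_ne hc k (c.branch k i) (c.branch k i₁)
  have h3l := h3 l hl hl'
  by_cases e0 : c.branch k i₀ = c.branch k i
  · rcases tri (e0 ▸ hi) (e0 ▸ hl.symm) hl'.symm with h | h <;> linarith
  · by_cases e1 : c.branch k i₀ = c.branch k i₁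
    · rcases tri (e1 ▸ hi.symm) (e1 ▸ hl'.symm) hl.symm with h | h <;> linarith
    · exact (h3 i₀ e0 e1).false

/-- Generic points together with an embedded tree contained in their pencil realize the type of
the tree. A point of the pencil points to one of the branches at each vertex; either it points
into the ray of a leaf, or the ends of some edge point to each other. -/
theorem TreeCode.isRealizable (hc : c.IsTrivalent) (hgen : IsGenericConfig x)
    (hv : c.IsEmbeddingData v) (hx : c.IsPencilData v x) : (treeOf c hc).IsRealizable := by
  refine ⟨x, hgen, hv.line hc, Set.Subset.antisymm ?_ ?_⟩
  · rintro p ⟨k, w, hw, hp⟩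
    rcases w with i | l
    · obtain ⟨τ, h0, rfl⟩ := (TreeCode.mem_edgeCell_inl_iff (c := c) hw).1 hp
      rw [mk_mem_conicPencil_iff]
      have hk : c.2 i = k := hw
      subst hk
      exact hx.inPencil_ray i h0
    · obtain ⟨T, hT, r, h⟩ := hv.exists_length hc hw
      obtain ⟨τ, h0, h1, rfl⟩ := (TreeCode.mem_edgeCell_inr_iff (c := c) hT h).1 hp
      rw [mk_mem_conicPencil_iff]
      exact hx.inPencil_edge hw h h0 h1
  · intro p hp
    obtain ⟨a, rfl⟩ := Submodule.Quotient.mk_surjective _ p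
    change TropProj.mk a ∈ _ at hp
    rw [mk_mem_conicPencil_iff] at hp
    choose g hg hpt using TreeCode.exists_pointsTo hc hv hx hgen.genericMinors hp
    by_cases hleaf : ∃ k i, g k = Sum.inl i
    · obtain ⟨k, i, hki⟩ := hleaf
      have hadj := hg k
      rw [hki] at hadj
      obtain ⟨m, hm⟩ := hpt k
      refine ⟨k, _, hadj, (TreeCode.mem_edgeCell_inl_iff (c := c) hadj).2
        ⟨a i - v k i - m, by linarith [(hm i).1], TropProj.mk_eq_mk_iff.2 ⟨m, fun j => ?_⟩⟩⟩
      by_cases hj : c.branch k j = Sum.inl i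
      · rw [if_pos hj, (TreeCode.branch_eq_inl_iff.1 hj).2]
        ring
      · rw [if_neg hj, (hm j).2 (by rwa [hki])]
        ring
    · have hint : ∀ k, ∃ l, g k = Sum.inr l := by
        intro k
        rcases h : g k with i | l
        · exact absurd ⟨k, i, h⟩ hleaf
        · exact ⟨l, rfl⟩
      choose g' hg' using hint
      have hadj (k) : SkelAdj c.1 k (g' k) := by
        have := hg k
        rw [hg'] at this
        exact this
      obtain ⟨k, hk⟩ := exists_mutual c.1 g' hadj
      have hkl := hadj k
      have hpk := hpt k
      have hpl := hpt (g' k)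
      rw [hg'] at hpk hpl
      rw [hk] at hpl
      set l := g' k with hl
      obtain ⟨T, hT, r, h⟩ := hv.exists_length hc hkl
      obtain ⟨m, hm⟩ := hpk
      obtain ⟨n, hn⟩ := hpl
      have hin (i) (hi : c.branch k i = Sum.inr l) : a i = v l i + n :=
        (hn i).2 fun h' => (TreeCode.branch_rev hkl i).1 h' hi
      obtain ⟨i₀, hi₀⟩ := TreeCode.exists_branch_eq (w := Sum.inr l) hc hkl
      obtain ⟨j₀, hj₀, -⟩ := TreeCode.exists_branch_ne hc k (Sum.inr l) (Sum.inr l)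
      refine ⟨k, Sum.inr l, hkl, (TreeCode.mem_edgeCell_inr_iff (c := c) hT h).2
        ⟨T + r + n - m, ?_, ?_, TropProj.mk_eq_mk_iff.2 ⟨m, fun j => ?_⟩⟩⟩
      · have h1 := (hm i₀).1
        rw [hin i₀ hi₀, h i₀, if_pos hi₀] at h1
        linarith
      · have h1 := (hn j₀).1
        rw [(hm j₀).2 hj₀, h j₀, if_neg hj₀] at h1
        linarith
      · by_cases hj : c.branch k j = Sum.inr l
        · rw [if_pos hj, hin j hj, h j, if_pos hj]
          ring
        · rw [if_neg hj, (hm j).2 hj]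
          ring

end Sufficiency

/-! ### Realizations of the noncrossing trees -/

section Realizations

/-- Four points `(x, y, 0)` of the tropical plane with integer coordinates, the code of a tree, and
integer positions of its internal vertices in the space of conics. -/
structure Realization where
  code : TreeCode
  pt : Fin 4 → Fin 2 → ℤ
  pos : Fin 4 → Fin 6 → ℤ

namespace Realization

/-- The matrix of monomials. -/
def entry (d : Realization) (s : Fin 4) : Fin 6 → ℤ :=
  ![2 * d.pt s 0, d.pt s 0 + d.pt s 1, 2 * d.pt s 1, d.pt s 1, 0, d.pt s 0]

/-- A term of the tropical determinant of the columns `g`. -/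
def cost (d : Realization) (g : Fin 4 → Fin 6) (σ : Equiv.Perm (Fin 4)) : ℤ :=
  d.entry 0 (g (σ 0)) + d.entry 1 (g (σ 1)) + d.entry 2 (g (σ 2)) + d.entry 3 (g (σ 3))

/-- The tropical determinant of the columns `g` is attained once. -/
def UniqueMin (d : Realization) (g : Fin 4 → Fin 6) : Prop :=
  ∃ σ, ∀ τ, d.cost g τ ≤ d.cost g σ → τ = σ

instance (d : Realization) : DecidablePred d.UniqueMin := fun g => by
  unfold UniqueMin; infer_instance

/-- The maximal minors of the matrix of monomials are tropically nonsingular. -/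
def IsGeneric (d : Realization) : Prop :=
  ∀ g₀ g₁, g₀ < g₁ → ∀ g₂, g₁ < g₂ → ∀ g₃, g₂ < g₃ → d.UniqueMin ![g₀, g₁, g₂, g₃]

/-- The integral form of `TreeCode.IsEmbeddingData`. -/
def IsEmbedding (d : Realization) : Prop :=
  ∀ k m, m ≠ k → ∀ j, d.code.branch k j ≠ Sum.inr (skelNext d.code.1 k m) → ∀ i,
    if d.code.branch k i = Sum.inr (skelNext d.code.1 k m)
    then d.pos m j - d.pos k j < d.pos m i - d.pos k i
    else d.pos m i - d.pos k i = d.pos m j - d.pos k j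

/-- The monomial `i` is minimizing at the point `s` of the conic in position `k`. -/
def Tight (d : Realization) (k s : Fin 4) (i : Fin 6) : Prop :=
  ∀ j, d.entry s i + d.pos k i ≤ d.entry s j + d.pos k j

instance (d : Realization) (k s : Fin 4) (i : Fin 6) : Decidable (d.Tight k s i) := by
  unfold Tight; infer_instance

/-- The integral form of `TreeCode.IsPencilData`. -/
def IsPencil (d : Realization) : Prop :=
  (∀ k l, SkelAdj d.code.1 k l → ∀ s, ∃ i, (d.Tight k s i ∧ d.Tight l s i) ∧ ∃ j, i ≠ j ∧
    (d.code.branch k i = Sum.inr l ↔ d.code.branch k j = Sum.inr l) ∧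
    d.Tight k s j ∧ d.Tight l s j) ∧
  ∀ m s, ∃ i, i ≠ m ∧ d.Tight (d.code.2 m) s i ∧
    ∃ j, i ≠ j ∧ j ≠ m ∧ d.Tight (d.code.2 m) s j

instance : DecidablePred IsGeneric := fun d => by unfold IsGeneric; infer_instance
instance : DecidablePred IsEmbedding := fun d => by unfold IsEmbedding; infer_instance
instance : DecidablePred IsPencil := fun d => by unfold IsPencil; infer_instance

end Realization

/-- Realizations of the noncrossing trees. -/
def realizations : List Realization := [
  ⟨(false, ![0, 0, 1, 2, 3, 3]), ![![1, 0], ![2, 2], ![0, -2], ![-2, -2]],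
    ![![2, 2, 3, 1, 2, 0], ![1, 1, 3, 1, 2, 0], ![0, 0, 2, 1, 2, 0], ![0, 0, 2, 1, 3, 1]]⟩,
  ⟨(false, ![0, 0, 1, 3, 3, 2]), ![![0, -2], ![1, 2], ![3, 3], ![-3, 0]],
    ![![4, 1, 2, 0, 3, 1], ![3, 0, 2, 0, 3, 1], ![3, 0, 2, 1, 4, 2], ![3, 0, 2, 2, 5, 2]]⟩,
  ⟨(false, ![0, 0, 2, 3, 3, 1]), ![![1, -2], ![-1, 2], ![2, 0], ![-2, 0]],
    ![![3, 1, 2, 0, 0, 1], ![2, 0, 2, 0, 0, 1], ![2, 0, 3, 1, 1, 1], ![2, 0, 3, 2, 2, 1]]⟩,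
  ⟨(false, ![0, 0, 3, 3, 2, 1]), ![![1, 0], ![-2, 0], ![2, -2], ![-1, 2]],
    ![![3, 1, 2, 0, 0, 1], ![2, 0, 2, 0, 0, 1], ![2, 0, 3, 1, 1, 1], ![2, 0, 4, 2, 1, 1]]⟩,
  ⟨(false, ![0, 1, 2, 3, 3, 0]), ![![2, 0], ![-2, 0], ![0, -2], ![-1, -1]],
    ![![3, 1, 2, 0, 0, 1], ![2, 1, 2, 0, 0, 0], ![2, 1, 3, 1, 1, 0], ![2, 1, 3, 2, 2, 0]]⟩,
  ⟨(false, ![0, 1, 3, 3, 2, 0]), ![![-1, 1], ![-2, 2], ![1, -1], ![1, 2]],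
    ![![5, 1, 1, 0, 2, 3], ![4, 1, 1, 0, 2, 2], ![3, 0, 1, 0, 2, 1], ![3, 0, 2, 1, 2, 1]]⟩,
  ⟨(false, ![0, 2, 3, 3, 1, 0]), ![![1, -2], ![-1, 1], ![2, 2], ![0, -1]],
    ![![2, 0, 2, 0, 2, 1], ![1, 0, 2, 0, 2, 0], ![1, 1, 3, 1, 2, 0], ![1, 1, 4, 2, 2, 0]]⟩,
  ⟨(false, ![0, 3, 3, 2, 1, 0]), ![![-1, -2], ![-2, 2], ![1, 2], ![0, 0]],
    ![![4, 0, 1, 0, 2, 2], ![3, 0, 1, 0, 2, 1], ![2, 0, 1, 0, 1, 0], ![2, 1, 2, 0, 1, 0]]⟩,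
  ⟨(false, ![1, 0, 0, 2, 3, 3]), ![![0, 2], ![-1, -3], ![2, -1], ![-2, -1]],
    ![![2, 2, 4, 1, 0, 0], ![2, 1, 3, 1, 0, 0], ![1, 0, 2, 1, 0, 0], ![1, 0, 2, 1, 1, 1]]⟩,
  ⟨(false, ![1, 0, 0, 3, 3, 2]), ![![0, 1], ![-2, -2], ![2, 2], ![-2, 0]],
    ![![3, 2, 2, 0, 2, 1], ![3, 1, 1, 0, 2, 1], ![2, 0, 0, 0, 2, 1], ![2, 0, 0, 1, 3, 1]]⟩,
  ⟨(false, ![2, 0, 0, 1, 3, 3]), ![![-3, 1], ![-2, 3], ![-3, -3], ![3, -1]],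
    ![![5, 4, 4, 1, 0, 2], ![5, 2, 2, 1, 0, 2], ![5, 1, 1, 0, 0, 2], ![5, 1, 1, 0, 1, 3]]⟩,
  ⟨(false, ![2, 1, 0, 0, 3, 3]), ![![1, -1], ![2, 2], ![0, 0], ![2, -2]],
    ![![0, 1, 5, 3, 2, 0], ![0, 1, 4, 2, 2, 0], ![0, 0, 3, 1, 2, 0], ![0, 0, 3, 1, 3, 1]]⟩,
  ⟨(true, ![0, 0, 1, 1, 2, 2]), ![![2, 2], ![0, -1], ![1, -2], ![-2, -2]],
    ![![2, 2, 3, 1, 2, 0], ![1, 1, 4, 2, 2, 0], ![0, 0, 2, 0, 2, 0], ![1, 1, 3, 1, 2, 0]]⟩,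
  ⟨(true, ![0, 1, 1, 2, 2, 0]), ![![-1, 1], ![-2, -2], ![1, 2], ![-2, 2]],
    ![![5, 1, 1, 0, 2, 3], ![4, 2, 2, 0, 2, 2], ![3, 0, 0, 0, 2, 1], ![4, 1, 1, 0, 2, 2]]⟩]

theorem isGeneric_realizations : ∀ d ∈ realizations, d.IsGeneric := by
  decide +kernel

theorem isEmbedding_realizations : ∀ d ∈ realizations, d.IsEmbedding := by
  decide +kernel

theorem isPencil_realizations : ∀ d ∈ realizations, d.IsPencil := by
  decide +kernel

end Realizations

/-! ### Counting the realizable trees -/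

section Final

namespace Realization

/-- The four points as real homogeneous coordinates. -/
def realPt (d : Realization) : Fin 4 → Fin 3 → ℝ := fun s => ![d.pt s 0, d.pt s 1, 0]

/-- The positions of the internal vertices as real homogeneous coordinates. -/
def realPos (d : Realization) : Fin 4 → Fin 6 → ℝ := fun k i => d.pos k i

theorem conicMatrix_realPt (d : Realization) (s : Fin 4) (i : Fin 6) :
    conicMatrix d.realPt s i = d.entry s i := by
  fin_cases i <;>
    simp [conicMatrix, conicMonomial, conicSupport, Fin.sum_univ_three, realPt, entry]

theorem IsGeneric.isGenericConfig {d : Realization} (hd : d.IsGeneric) :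
    IsGenericConfig d.realPt := by
  rintro I ⟨σ, τ, hne, hσ, hτ⟩
  have hI : ![I 0, I 1, I 2, I 3] = I := by
    ext j; fin_cases j <;> rfl
  have hlt {i j : Fin 4} (h : i < j) : I i < I j := I.strictMono h
  obtain ⟨ρ, hρ⟩ := hd _ _ (hlt (by decide : (0 : Fin 4) < 1)) _
    (hlt (by decide : (1 : Fin 4) < 2)) _ (hlt (by decide : (2 : Fin 4) < 3))
  rw [hI] at hρ
  have hcost (π : Equiv.Perm (Fin 4)) :
      ∑ s, (conicMatrix d.realPt).submatrix id I s (π s) = d.cost I π := by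
    simp [conicMatrix_realPt, cost, Fin.sum_univ_four]
  have key (π : Equiv.Perm (Fin 4)) (hπ : ∑ s, (conicMatrix d.realPt).submatrix id I s (π s) =
      tropDet ((conicMatrix d.realPt).submatrix id I)) : π = ρ := by
    refine hρ π ?_
    have : tropDet ((conicMatrix d.realPt).submatrix id I) ≤ d.cost I ρ :=
      (inf'_le _ (mem_univ ρ)).trans (hcost ρ).le
    rw [← hπ, hcost] at this
    exact_mod_cast this
  exact hne ((key σ hσ).trans (key τ hτ).symm)

theorem IsEmbedding.isEmbeddingData {d : Realization} (hd : d.IsEmbedding) :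
    d.code.IsEmbeddingData d.realPos where
  eq_of_ne k m hmk i j hi hj := by
    have := hd k m hmk j hj i
    rw [if_neg hi] at this
    simp only [realPos]
    exact_mod_cast this
  lt_of_eq k m hmk i j hi hj := by
    have := hd k m hmk j hj i
    rw [if_pos hi] at this
    simp only [realPos]
    exact_mod_cast this

theorem Tight.isTight {d : Realization} {k s : Fin 4} {i : Fin 6} (h : d.Tight k s i) :
    IsTight (fun s i => conicMatrix d.realPt s i + d.realPos k i) s i := by
  intro j
  simp only [conicMatrix_realPt, realPos]
  exact_mod_cast h j

theorem IsPencil.isPencilData {d : Realization} (hd : d.IsPencil) :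
    d.code.IsPencilData d.realPos d.realPt where
  edge k l hkl s := by
    obtain ⟨i, ⟨h1, h2⟩, j, hij, hb, h3, h4⟩ := hd.1 k l hkl s
    exact ⟨i, j, hij, hb, ⟨h1.isTight, h3.isTight⟩, h2.isTight, h4.isTight⟩
  ray m s := by
    obtain ⟨i, him, hi, j, hij, hjm, hj⟩ := hd.2 m s
    exact ⟨i, j, hij, him, hjm, hi.isTight, hj.isTight⟩

end Realization

theorem codes_realizations : ∀ d ∈ realizations, d.code ∈ treeCodes ∧ d.code.IsNoncrossing := by
  have : ∀ d ∈ realizations, (d.code.IsTrivalent ∧ d.code.IsCanonical) ∧ d.code.IsNoncrossing := by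
    decide +kernel
  intro d hd
  rw [mem_treeCodes]
  exact this d hd

theorem card_noncrossing_treeCodes : #(treeCodes.filter TreeCode.IsNoncrossing) = 14 := by
  rw [treeCodes, filter_filter]
  decide +kernel

theorem filter_isNoncrossing_treeCodes :
    treeCodes.filter TreeCode.IsNoncrossing = (realizations.map Realization.code).toFinset := by
  refine (eq_of_subset_of_card_le ?_ ?_).symm
  · intro c hc
    simp only [List.mem_toFinset, List.mem_map] at hc
    obtain ⟨d, hd, rfl⟩ := hc
    exact mem_filter.2 (codes_realizations d hd)
  · rw [card_noncrossing_treeCodes]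
    decide +kernel

theorem typeOfCode_mem_realizableTypes_iff (c : treeCodes) :
    typeOfCode c ∈ realizableTypes ↔ c.1.IsNoncrossing := by
  constructor
  · rintro ⟨Γ, hΓ, x, hx, L, hL⟩
    obtain ⟨π, hπ⟩ := mk_eq_typeOfCode_iff.1 hΓ
    exact L.isNoncrossing_code hπ (mem_treeCodes.1 c.2).1 hx hL
  · intro hc
    have : c.1 ∈ treeCodes.filter TreeCode.IsNoncrossing := mem_filter.2 ⟨c.2, hc⟩
    rw [filter_isNoncrossing_treeCodes, List.mem_toFinset, List.mem_map] at this
    obtain ⟨c, hcm⟩ := c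
    obtain ⟨d, hd, rfl⟩ := this
    exact ⟨_, rfl, TreeCode.isRealizable _ (isGeneric_realizations d hd).isGenericConfig
      (isEmbedding_realizations d hd).isEmbeddingData (isPencil_realizations d hd).isPencilData⟩

theorem TrivalentTree.HasCode.isCaterpillar_iff {Γ : TrivalentTree} {c : TreeCode}
    {π : Equiv.Perm (Fin 4)} (h : Γ.HasCode c π) (hc : c.IsTrivalent) :
    Γ.IsCaterpillar ↔ c.1 = false := by
  have h1 : Γ.IsCaterpillar ↔ ∀ k, 0 < leafCount c.2 k := by
    refine π.forall_congr_right.symm.trans (forall_congr' fun k => ?_)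
    rw [leafCount_eq, card_pos]
    refine exists_congr fun i => ?_
    rw [mem_filter]
    exact (h (Sum.inr k) (Sum.inl i)).symm.trans (by simp [treeGraph])
  rw [h1]
  obtain ⟨_ | _, l⟩ := c
  · obtain ⟨h1, h2, h0, h3⟩ : leafCount l 1 = 1 ∧ leafCount l 2 = 1 ∧ leafCount l 0 = 2 ∧
      leafCount l 3 = 2 := hc
    refine ⟨fun _ => rfl, fun _ k => ?_⟩
    fin_cases k <;> simp [*]
  · have h3 : leafCount l 3 = 0 := hc.1
    refine ⟨fun h => absurd (h 3) ?_, fun h => absurd h (by simp)⟩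
    simp [h3]

theorem TrivalentTree.isSnowflake_iff (Γ : TrivalentTree) :
    Γ.IsSnowflake ↔ ¬ Γ.IsCaterpillar := by
  simp [TrivalentTree.IsSnowflake, TrivalentTree.IsCaterpillar]

theorem typeOfCode_mem_caterpillarTypes_iff (c : treeCodes) :
    typeOfCode c ∈ caterpillarTypes ↔ c.1.1 = false := by
  constructor
  · rintro ⟨Γ, hΓ, h⟩
    obtain ⟨π, hπ⟩ := mk_eq_typeOfCode_iff.1 hΓ
    exact (hπ.isCaterpillar_iff (mem_treeCodes.1 c.2).1).1 h
  · intro h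
    obtain ⟨π, hπ⟩ := mk_eq_typeOfCode_iff.1 (rfl : typeOfCode c = typeOfCode c)
    exact ⟨_, rfl, (hπ.isCaterpillar_iff (mem_treeCodes.1 c.2).1).2 h⟩

theorem typeOfCode_mem_snowflakeTypes_iff (c : treeCodes) :
    typeOfCode c ∈ snowflakeTypes ↔ c.1.1 = true := by
  rw [← Bool.not_eq_false]
  constructor
  · rintro ⟨Γ, hΓ, h⟩
    obtain ⟨π, hπ⟩ := mk_eq_typeOfCode_iff.1 hΓ
    rwa [← hπ.isCaterpillar_iff (mem_treeCodes.1 c.2).1, ← Γ.isSnowflake_iff]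
  · intro h
    obtain ⟨π, hπ⟩ := mk_eq_typeOfCode_iff.1 (rfl : typeOfCode c = typeOfCode c)
    rw [← hπ.isCaterpillar_iff (mem_treeCodes.1 c.2).1, ← TrivalentTree.isSnowflake_iff] at h
    exact ⟨_, rfl, h⟩

theorem ncard_eq_card_filter {S : Set TreeType} {P : TreeCode → Prop} [DecidablePred P]
    (h : ∀ c, typeOfCode c ∈ S ↔ P c.1) : S.ncard = #(treeCodes.filter P) := by
  rw [← Set.ncard_coe_finset]
  refine (Set.ncard_congr (fun c hc => typeOfCode ⟨c, (mem_filter.1 hc).1⟩) ?_ ?_ ?_).symm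
  · intro c hc
    exact (h _).2 (mem_filter.1 hc).2
  · intro c c' hc hc' he
    exact congrArg Subtype.val (bijective_typeOfCode.1 he)
  · intro T hT
    obtain ⟨c, rfl⟩ := bijective_typeOfCode.2 T
    exact ⟨c.1, mem_filter.2 ⟨c.2, (h c).1 hT⟩, rfl⟩

theorem mainTheorem2 :
    Nat.card TreeType = 105 ∧
    realizableTypes.ncard = 14 ∧
    (realizableTypes ∩ caterpillarTypes).ncard = 12 ∧
    (realizableTypes ∩ snowflakeTypes).ncard = 2 := by
  refine ⟨card_treeType, ?_, ?_, ?_⟩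
  · rw [ncard_eq_card_filter typeOfCode_mem_realizableTypes_iff, card_noncrossing_treeCodes]
  · rw [ncard_eq_card_filter (P := fun c => c.IsNoncrossing ∧ c.1 = false) fun c =>
      and_congr (typeOfCode_mem_realizableTypes_iff c) (typeOfCode_mem_caterpillarTypes_iff c),
      ← filter_filter, filter_isNoncrossing_treeCodes]
    decide +kernel
  · rw [ncard_eq_card_filter (P := fun c => c.IsNoncrossing ∧ c.1 = true) fun c =>
      and_congr (typeOfCode_mem_realizableTypes_iff c) (typeOfCode_mem_snowflakeTypes_iff c),
      ← filter_filter, filter_isNoncrossing_treeCodes]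
    decide +kernel

end Final
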